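/- **Conventions.** A space is locally compact if every point has a compact Hausdorff neighbourhood; it need not be Hausdorff, and compact sets need not be Hausdorff. For such a space $Y$, $\mathcal C_c(Y)$ is the linear span of the functions $Y\to\mathbf C$ obtained by extending by $0$ continuous compactly supported functions on open Hausdorff subsets of $Y$; $\mathcal C_c(Y)^+$ is its set of non-negative elements. A locally compact groupoid $G$ is a topological groupoid with locally compact topology, Hausdorff unit space $G^{(0)}\subset G$ (with the subspace topology), and open range and source maps $r,s$; $G^x=r^{-1}(x)$, which is Hausdorff. A continuous Haar system is a family $\lambda=(\lambda^x)_{x\in G^{(0)}}$ of Radon measures of full support on the fibres $G^x$ such that $x\mapsto\int f\,d\lambda^x$ is continuous for every $f\in\mathcal C_c(G)$ and $\gamma\lambda^{s(\gamma)}=\lambda^{r(\gamma)}$ for every $\gamma\in G$. A *topological approximate invariant mean* for $G$ is a sequence $(m_n)$ of families $m_n=(m_n^x)_{x\in G^{(0)}}$ of finite positive Radon measures $m_n^x$ on $G^x$ of mass at most one such that: $x\mapsto\int f\,dm_n^x$ is continuous for all $n$ and all $f\in\mathcal C_c(G)$; $\|m_n^x\|_1\to1$ uniformly on compact subsets of $G^{(0)}$;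 $\|\gamma m_n^{s(\gamma)}-m_n^{r(\gamma)}\|_1\to0$ uniformly on compact subsets of $G$. Here $\|\cdot\|_1$ is the total variation norm. A *topological approximate invariant density* for $(G,\lambda)$ is a sequence $(g_n)$ in $\mathcal C_c(G)^+$ such that: $\int g_n\,d\lambda^x\le1$ for all $n$ and $x$; $\int g_n\,d\lambda^x\to1$ uniformly on compact subsets of $G^{(0)}$; $\int|g_n(\gamma^{-1}\gamma_1)-g_n(\gamma_1)|\,d\lambda^{r(\gamma)}(\gamma_1)\to0$ uniformly on compact subsets of $G$. **Theorem.** Let $G$ be a $\sigma$-compact locally compact groupoid, not necessarily Hausdorff, with a continuous Haar system $\lambda$. Let $T$ be a locally compact Hausdorff space and $p:G^{(0)}\to T$ a continuous open surjection with $p\circ r=p\circ s$. For $t\in T$ let $X(t)=p^{-1}(t)$ and let $G(t)=G|_{X(t)}$ be the reduction of $G$ to $X(t)$, with the restricted family $\lambda_t=(\lambda^x)_{x\in X(t)}$. 1. $(G,\lambda)$ is topologically amenable in the sense of having a topological approximate invariant density if and only if $(G(t),\lambda_t)$ has one for every $t\in T$. 2. If $G$ is topologically amenable in the sense of having a topological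 approximate invariant mean, then so is $G(t)$ for every $t\in T$. If $G$ is Hausdorff, the converse holds as well: if every $G(t)$ has a topological approximate invariant mean, then so does $G$. -/

import Mathlib

open MeasureTheory Filter Topology

/-- A (not necessarily Hausdorff) locally compact space: every point has a compact Hausdorff
neighbourhood. Compact sets are not required to be Hausdorff. -/
def IsLocallyCompactSpace (Y : Type*) [TopologicalSpace Y] : Prop :=
  ∀ y : Y, ∃ K ∈ 𝓝 y, IsCompact K ∧ T2Space K

/-- The space `𝒞_c(Y)` of a locally compact, possibly non-Hausdorff space `Y`: the linear span of
the functions `Y → ℂ` that are obtained from a continuous compactly supported function on an open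
Hausdorff subset `U` by extending it by zero. If `Y` is Hausdorff this is `C_c(Y)`. -/
def ccSpan (Y : Type*) [TopologicalSpace Y] : Submodule ℂ (Y → ℂ) :=
  Submodule.span ℂ {f | ∃ U : Set Y, IsOpen U ∧ T2Space U ∧ ContinuousOn f U ∧
    ∃ K ⊆ U, IsCompact K ∧ ∀ y ∉ K, f y = 0}

/-- The total variation norm `‖μ - ν‖₁` of the difference of two finite positive measures. -/
noncomputable def tvNormSub {α : Type*} [MeasurableSpace α] (μ ν : FiniteMeasure α) : ℝ :=
  (((μ : Measure α).toSignedMeasure - (ν : Measure α).toSignedMeasure).totalVariation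
    Set.univ).toReal

/-- A topological groupoid `G` with unit space `X`: the unit space is Hausdorff and carries the
subspace topology, the structure maps are continuous, the range and source maps are open. The
space `G` is not assumed to be Hausdorff. The product `mul a b` is defined if `s a = r b`. -/
structure TopGroupoid (G X : Type*) [TopologicalSpace G] [TopologicalSpace X] where
  r : G → X
  s : G → X
  unit : X → G
  inv : G → G
  mul : (a b : G) → s a = r b → G
  r_unit : ∀ x, r (unit x) = x
  s_unit : ∀ x, s (unit x) = x
  r_inv : ∀ a, r (inv a) = s a
  s_inv : ∀ a, s (inv a) = r a
  r_mul : ∀ a b h, r (mul a b h) = r a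
  s_mul : ∀ a b h, s (mul a b h) = s b
  mul_assoc : ∀ a b c (h : s a = r b) (h' : s b = r c),
    mul (mul a b h) c ((s_mul a b h).trans h') = mul a (mul b c h') (h.trans (r_mul b c h').symm)
  unit_mul : ∀ a, mul (unit (r a)) a (s_unit _) = a
  mul_unit : ∀ a, mul a (unit (s a)) (r_unit _).symm = a
  inv_mul : ∀ a, mul (inv a) a (s_inv a) = unit (s a)
  mul_inv : ∀ a, mul a (inv a) (r_inv a).symm = unit (r a)
  t2Space_units : T2Space X
  isEmbedding_unit : IsEmbedding unit
  continuous_r : Continuous r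
  continuous_s : Continuous s
  isOpenMap_r : IsOpenMap r
  isOpenMap_s : IsOpenMap s
  continuous_inv : Continuous inv
  continuous_mul : Continuous fun q : {q : G × G // s q.1 = r q.2} => mul q.1.1 q.1.2 q.2

namespace TopGroupoid

variable {G X T : Type*} [TopologicalSpace G] [TopologicalSpace X] [TopologicalSpace T]

/-- The fibre `G^x = r⁻¹(x)`, with the subspace topology and its Borel structure. -/
def Fiber (𝒢 : TopGroupoid G X) (x : X) : Type _ := {γ : G // 𝒢.r γ = x}

instance (𝒢 : TopGroupoid G X) (x : X) : TopologicalSpace (𝒢.Fiber x) :=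
  inferInstanceAs (TopologicalSpace {γ : G // 𝒢.r γ = x})

instance (𝒢 : TopGroupoid G X) (x : X) : MeasurableSpace (𝒢.Fiber x) := borel _

instance (𝒢 : TopGroupoid G X) (x : X) : BorelSpace (𝒢.Fiber x) := ⟨rfl⟩

/-- Left translation `γ₁ ↦ γ γ₁` from `G^{s(γ)}` to `G^{r(γ)}`. -/
def translate (𝒢 : TopGroupoid G X) (γ : G) (γ₁ : 𝒢.Fiber (𝒢.s γ)) : 𝒢.Fiber (𝒢.r γ) :=
  ⟨𝒢.mul γ γ₁.1 γ₁.2.symm, 𝒢.r_mul _ _ _⟩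

theorem continuous_translate (𝒢 : TopGroupoid G X) (γ : G) : Continuous (𝒢.translate γ) := by
  refine Continuous.subtype_mk ?_ _
  exact 𝒢.continuous_mul.comp
    (f := fun γ₁ : 𝒢.Fiber (𝒢.s γ) =>
      (⟨(γ, γ₁.1), γ₁.2.symm⟩ : {q : G × G // 𝒢.s q.1 = 𝒢.r q.2}))
    (Continuous.subtype_mk (continuous_const.prodMk continuous_subtype_val) _)

theorem measurable_translate (𝒢 : TopGroupoid G X) (γ : G) : Measurable (𝒢.translate γ) :=
  (𝒢.continuous_translate γ).measurable

/-- A continuous Haar system: a family of Radon measures `lam x` on the fibres `G^x`, of full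
support, continuous and left invariant. -/
structure IsHaarSystem (𝒢 : TopGroupoid G X) (lam : (x : X) → Measure (𝒢.Fiber x)) : Prop where
  regular : ∀ x, (lam x).Regular
  fullSupport : ∀ x, (lam x).IsOpenPosMeasure
  continuous : ∀ f ∈ ccSpan G, Continuous fun x => ∫ γ, f γ.1 ∂(lam x)
  invariant : ∀ γ, (lam (𝒢.s γ)).map (𝒢.translate γ) = lam (𝒢.r γ)

/-- Existence of a topological approximate invariant mean: a sequence of continuous families
`m n x` of finite positive Radon measures on `G^x`, of mass at most one, such that
`‖m n x‖₁ → 1` uniformly on the compact subsets of the unit space and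
`‖γ m n (s γ) - m n (r γ)‖₁ → 0` uniformly on the compact subsets of `G`. -/
def HasApproxInvariantMean (𝒢 : TopGroupoid G X) : Prop :=
  ∃ m : ℕ → (x : X) → FiniteMeasure (𝒢.Fiber x),
    (∀ n x, (m n x : Measure (𝒢.Fiber x)).Regular) ∧
    (∀ n x, (m n x).mass ≤ 1) ∧
    (∀ n, ∀ f ∈ ccSpan G, Continuous fun x => ∫ γ, f γ.1 ∂(m n x : Measure (𝒢.Fiber x))) ∧
    (∀ L : Set X, IsCompact L →
      TendstoUniformlyOn (fun n x => ((m n x).mass : ℝ)) (fun _ => 1) atTop L) ∧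
    (∀ K : Set G, IsCompact K →
      TendstoUniformlyOn
        (fun n γ => tvNormSub ((m n (𝒢.s γ)).map (𝒢.translate γ)) (m n (𝒢.r γ)))
        (fun _ => 0) atTop K)

/-- Existence of a topological approximate invariant density with respect to the family `lam`:
a sequence `g n` of non-negative elements of `𝒞_c(G)` such that `∫ g n dλ^x ≤ 1` for all `x`,
`∫ g n dλ^x → 1` uniformly on the compact subsets of the unit space and
`∫ |g n (γ⁻¹ γ₁) - g n γ₁| dλ^{r(γ)}(γ₁) → 0` uniformly on the compact subsets of `G`. -/
def HasApproxInvariantDensity (𝒢 : TopGroupoid G X) (lam : (x : X) → Measure (𝒢.Fiber x)) :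
    Prop :=
  ∃ g : ℕ → G → ℝ,
    (∀ n, (fun γ => (g n γ : ℂ)) ∈ ccSpan G) ∧
    (∀ n γ, 0 ≤ g n γ) ∧
    (∀ n x, ∫ γ, g n γ.1 ∂(lam x) ≤ 1) ∧
    (∀ L : Set X, IsCompact L →
      TendstoUniformlyOn (fun n x => ∫ γ, g n γ.1 ∂(lam x)) (fun _ => 1) atTop L) ∧
    (∀ K : Set G, IsCompact K →
      TendstoUniformlyOn
        (fun n γ => ∫ γ₁ : 𝒢.Fiber (𝒢.r γ),
          |g n (𝒢.mul (𝒢.inv γ) γ₁.1 ((𝒢.s_inv γ).trans γ₁.2.symm)) - g n γ₁.1|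
            ∂(lam (𝒢.r γ)))
        (fun _ => 0) atTop K)

/-- The space of arrows of the reduction `G|_A = r⁻¹(A) ∩ s⁻¹(A)`. -/
abbrev RedArrows (𝒢 : TopGroupoid G X) (A : Set X) : Type _ :=
  {γ : G // 𝒢.r γ ∈ A ∧ 𝒢.s γ ∈ A}

/-- The reduction `G|_A` of `G` to an invariant subset `A` of the unit space, with the subspace
topologies. -/
def reduction (𝒢 : TopGroupoid G X) (A : Set X) (hA : ∀ γ, 𝒢.r γ ∈ A ↔ 𝒢.s γ ∈ A) :
    TopGroupoid (𝒢.RedArrows A) A where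
  r γ := ⟨𝒢.r γ.1, γ.2.1⟩
  s γ := ⟨𝒢.s γ.1, γ.2.2⟩
  unit x := ⟨𝒢.unit x.1, by rw [𝒢.r_unit]; exact x.2, by rw [𝒢.s_unit]; exact x.2⟩
  inv γ := ⟨𝒢.inv γ.1, by rw [𝒢.r_inv]; exact γ.2.2, by rw [𝒢.s_inv]; exact γ.2.1⟩
  mul a b h := ⟨𝒢.mul a.1 b.1 (congrArg Subtype.val h),
    by rw [𝒢.r_mul]; exact a.2.1, by rw [𝒢.s_mul]; exact b.2.2⟩
  r_unit x := Subtype.ext (𝒢.r_unit x.1)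
  s_unit x := Subtype.ext (𝒢.s_unit x.1)
  r_inv a := Subtype.ext (𝒢.r_inv a.1)
  s_inv a := Subtype.ext (𝒢.s_inv a.1)
  r_mul a b h := Subtype.ext (𝒢.r_mul a.1 b.1 _)
  s_mul a b h := Subtype.ext (𝒢.s_mul a.1 b.1 _)
  mul_assoc a b c h h' := Subtype.ext (𝒢.mul_assoc a.1 b.1 c.1 _ _)
  unit_mul a := Subtype.ext (𝒢.unit_mul a.1)
  mul_unit a := Subtype.ext (𝒢.mul_unit a.1)
  inv_mul a := Subtype.ext (𝒢.inv_mul a.1)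
  mul_inv a := Subtype.ext (𝒢.mul_inv a.1)
  t2Space_units := by
    have := 𝒢.t2Space_units
    infer_instance
  isEmbedding_unit := by
    refine IsEmbedding.of_comp (Continuous.subtype_mk
      (𝒢.isEmbedding_unit.continuous.comp continuous_subtype_val) _) continuous_subtype_val ?_
    exact 𝒢.isEmbedding_unit.comp IsEmbedding.subtypeVal
  continuous_r := (𝒢.continuous_r.comp continuous_subtype_val).subtype_mk _
  continuous_s := (𝒢.continuous_s.comp continuous_subtype_val).subtype_mk _
  isOpenMap_r := by
    rintro _ ⟨V, hV, rfl⟩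
    refine ⟨𝒢.r '' V, 𝒢.isOpenMap_r V hV, ?_⟩
    ext x
    constructor
    · rintro ⟨γ, hγ, hx⟩
      have h : 𝒢.r γ ∈ A := by rw [hx]; exact x.2
      exact ⟨⟨γ, h, (hA γ).1 h⟩, hγ, Subtype.ext hx⟩
    · rintro ⟨γ, hγ, rfl⟩
      exact ⟨γ.1, hγ, rfl⟩
  isOpenMap_s := by
    rintro _ ⟨V, hV, rfl⟩
    refine ⟨𝒢.s '' V, 𝒢.isOpenMap_s V hV, ?_⟩
    ext x
    constructor
    · rintro ⟨γ, hγ, hx⟩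
      have h : 𝒢.s γ ∈ A := by rw [hx]; exact x.2
      exact ⟨⟨γ, (hA γ).2 h, h⟩, hγ, Subtype.ext hx⟩
    · rintro ⟨γ, hγ, rfl⟩
      exact ⟨γ.1, hγ, rfl⟩
  continuous_inv := (𝒢.continuous_inv.comp continuous_subtype_val).subtype_mk _
  continuous_mul := by
    refine Continuous.subtype_mk ?_ _
    exact 𝒢.continuous_mul.comp
      (f := fun q : {q : 𝒢.RedArrows A × 𝒢.RedArrows A //
          (⟨𝒢.s q.1.1, q.1.2.2⟩ : A) = ⟨𝒢.r q.2.1, q.2.2.1⟩} =>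
        (⟨(q.1.1.1, q.1.2.1), congrArg Subtype.val q.2⟩ : {q : G × G // 𝒢.s q.1 = 𝒢.r q.2}))
      (Continuous.subtype_mk
        ((continuous_subtype_val.comp (continuous_fst.comp continuous_subtype_val)).prodMk
          (continuous_subtype_val.comp (continuous_snd.comp continuous_subtype_val))) _)

/-- For `x` in an invariant set `A`, the identification of the fibre `G^x` with the fibre of the
reduction `G|_A` over `x`. -/
def fiberToReduction (𝒢 : TopGroupoid G X) (A : Set X) (hA : ∀ γ, 𝒢.r γ ∈ A ↔ 𝒢.s γ ∈ A)
    (x : A) : 𝒢.Fiber x.1 ≃ₜ (𝒢.reduction A hA).Fiber x where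
  toFun γ := ⟨⟨γ.1, by rw [γ.2]; exact x.2, (hA γ.1).1 (by rw [γ.2]; exact x.2)⟩,
    Subtype.ext γ.2⟩
  invFun γ := ⟨γ.1.1, congrArg Subtype.val γ.2⟩
  left_inv _ := rfl
  right_inv _ := rfl
  continuous_toFun := (continuous_subtype_val.subtype_mk _).subtype_mk _
  continuous_invFun := (continuous_subtype_val.comp continuous_subtype_val).subtype_mk _

/-- The restriction `(λ^x)_{x ∈ A}` of a family of measures on the fibres to the reduction
`G|_A`. -/
noncomputable def restrictSystem (𝒢 : TopGroupoid G X) (lam : (x : X) → Measure (𝒢.Fiber x))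
    (A : Set X) (hA : ∀ γ, 𝒢.r γ ∈ A ↔ 𝒢.s γ ∈ A) (x : A) :
    Measure ((𝒢.reduction A hA).Fiber x) :=
  (lam x.1).map (𝒢.fiberToReduction A hA x)

/-- `G` is a groupoid bundle over `T` through `p`: a continuous open surjection of the unit space
onto `T` with `p ∘ r = p ∘ s`. -/
structure IsGroupoidBundle (𝒢 : TopGroupoid G X) (p : X → T) : Prop where
  continuous : Continuous p
  isOpenMap : IsOpenMap p
  surjective : Function.Surjective p
  invariant : ∀ γ, p (𝒢.r γ) = p (𝒢.s γ)

theorem IsGroupoidBundle.preimage_invariant {𝒢 : TopGroupoid G X} {p : X → T}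
    (hp : 𝒢.IsGroupoidBundle p) (t : T) (γ : G) : 𝒢.r γ ∈ p ⁻¹' {t} ↔ 𝒢.s γ ∈ p ⁻¹' {t} := by
  simp only [Set.mem_preimage, Set.mem_singleton_iff, hp.invariant γ]

/-- The groupoid `G(t)`, the reduction of `G` to `X(t) = p⁻¹(t)`. -/
def bundleFiber (𝒢 : TopGroupoid G X) {p : X → T} (hp : 𝒢.IsGroupoidBundle p) (t : T) :
    TopGroupoid (𝒢.RedArrows (p ⁻¹' {t})) (p ⁻¹' {t}) :=
  𝒢.reduction (p ⁻¹' {t}) (hp.preimage_invariant t)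

/-- The Haar system of `G(t)`, the restriction of that of `G`. -/
noncomputable def bundleFiberSystem (𝒢 : TopGroupoid G X)
    (lam : (x : X) → Measure (𝒢.Fiber x)) {p : X → T} (hp : 𝒢.IsGroupoidBundle p) (t : T) :
    (x : p ⁻¹' {t}) → Measure ((𝒢.bundleFiber hp t).Fiber x) :=
  𝒢.restrictSystem lam (p ⁻¹' {t}) (hp.preimage_invariant t)

end TopGroupoid

/-! Restriction to the closed invariant set `X(t)` gives the implications from `G` to `G(t)`.
Restricted means stay continuous because functions in `𝒞_c(G(t))` extend to `𝒞_c(G)`.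

For the converse on densities, extend an approximately invariant density of `G(t)` to some `g` in
`𝒞_c(G)`. Its estimates (almost non-negative, integral almost at most one everywhere and almost one
on a compact set, small defect on a compact set) are one-sided and survive on all fibres of `p` near
`t`. Adding a small multiple of a fixed function and rescaling restores exact positivity and mass at
most one (`exists_approx_near_fiber`). A partition of unity on `T`, pulled back by `p ∘ r`, glues
finitely many such functions. As `p ∘ r = p ∘ s`, its coefficients are unchanged by translation, so
the defect of the glued function is at most the weighted sum of the defects.

If `G` is not Hausdorff, elements of `𝒞_c` may be discontinuous and their absolute values may leave
`𝒞_c`. Two facts replace continuity: extension from closed subspaces, by Tietze in Hausdorff charts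
(`exists_extension_mem_ccReal`), and the limit of a function along an ultrafilter as a finite sum of
its values at limit points (`exists_finset_tendsto_sum`). The latter makes non-negativity on a fibre
almost persist nearby, whence upper semicontinuity of fibrewise `L¹`-norms
(`eventually_integral_abs_lt`).

For Hausdorff `G`, means and densities are interchangeable: a density `g` gives the mean `g λ^x`,
and a mean, cut off and convolved with a normalized function, gives a density. The statement for
means then follows from the one for densities. -/

section CompactlySupported

/-! ### Compactly supported functions on non-Hausdorff locally compact spaces -/

variable {Y Z A : Type*} [TopologicalSpace Y] [TopologicalSpace Z] [TopologicalSpace A]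

theorem IsLocallyCompactSpace.exists_open_t2 (hY : IsLocallyCompactSpace Y) (y : Y) :
    ∃ U : Set Y, IsOpen U ∧ y ∈ U ∧ T2Space U := by
  obtain ⟨K, hK, -, hT⟩ := hY y
  refine ⟨interior K, isOpen_interior, mem_interior_iff_mem_nhds.2 hK, ?_⟩
  exact T2Space.of_injective_continuous (f := Set.inclusion interior_subset)
    (Set.inclusion_injective _) (continuous_inclusion _)

theorem IsLocallyCompactSpace.locallyCompactSpace (hY : IsLocallyCompactSpace Y) :
    LocallyCompactSpace Y := by
  refine ⟨fun y n hn => ?_⟩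
  obtain ⟨K, hK, hKc, hT⟩ := hY y
  have : CompactSpace K := isCompact_iff_compactSpace.1 hKc
  have hyK : y ∈ K := mem_of_mem_nhds hK
  have hn' : (Subtype.val : K → Y) ⁻¹' n ∈ 𝓝 (⟨y, hyK⟩ : K) :=
    continuous_subtype_val.continuousAt hn
  obtain ⟨N, hN, hNn, hNc⟩ := local_compact_nhds hn'
  refine ⟨Subtype.val '' N, ?_, ?_, hNc.image continuous_subtype_val⟩
  · rw [nhds_subtype_eq_comap, mem_comap] at hN
    obtain ⟨V, hV, hVN⟩ := hN
    filter_upwards [hV, hK] with z hzV hzK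
    exact ⟨⟨z, hzK⟩, hVN hzV, rfl⟩
  · rintro _ ⟨z, hz, rfl⟩
    exact hNn hz

/-- Closedness of points is a local matter, and each point has a Hausdorff neighbourhood. The
Hausdorff property of the fibres `G^x` rests on this. -/
theorem IsLocallyCompactSpace.t1Space (hY : IsLocallyCompactSpace Y) : T1Space Y := by
  refine ⟨fun y => ?_⟩
  rw [← isOpen_compl_iff, isOpen_iff_mem_nhds]
  intro z hz
  obtain ⟨U, hU, hzU, hT⟩ := hY.exists_open_t2 z
  by_cases hy : y ∈ U
  · have h : (⟨z, hzU⟩ : U) ≠ ⟨y, hy⟩ := fun h => hz (congrArg Subtype.val h)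
    have h1 := isOpen_compl_singleton.mem_nhds (show (⟨z, hzU⟩ : U) ∈ ({⟨y, hy⟩}ᶜ : Set U) from h)
    rw [nhds_subtype_eq_comap, mem_comap] at h1
    obtain ⟨V, hV, hVN⟩ := h1
    filter_upwards [hV, hU.mem_nhds hzU] with w hwV hwU hwy
    exact hVN (show (⟨w, hwU⟩ : U) ∈ _ from hwV) (Subtype.ext hwy)
  · filter_upwards [hU.mem_nhds hzU] with w hw hwy
    exact hy (by rw [← Set.mem_singleton_iff.1 hwy]; exact hw)

theorem IsLocallyCompactSpace.of_isClosedEmbedding (hY : IsLocallyCompactSpace Y) {j : A → Y}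
    (hj : IsClosedEmbedding j) : IsLocallyCompactSpace A := by
  intro a
  obtain ⟨K, hK, hKc, hT⟩ := hY (j a)
  refine ⟨j ⁻¹' K, hj.continuous.continuousAt hK, hj.isCompact_preimage hKc, ?_⟩
  exact T2Space.of_injective_continuous (f := K.restrictPreimage j)
    (hj.injective.restrictPreimage K) (hj.continuous.restrictPreimage)

/-- A function that is continuous on `U` and vanishes off a compact subset of `U`. -/
def IsBumpOn (U : Set Y) (f : Y → ℝ) : Prop :=
  ContinuousOn f U ∧ ∃ K ⊆ U, IsCompact K ∧ ∀ y ∉ K, f y = 0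

/-- The real-valued version of `𝒞_c(Y)`. -/
def ccReal (Y : Type*) [TopologicalSpace Y] : Submodule ℝ (Y → ℝ) :=
  Submodule.span ℝ {f | ∃ U : Set Y, IsOpen U ∧ T2Space U ∧ IsBumpOn U f}

theorem IsBumpOn.mem_ccReal {U : Set Y} (hU : IsOpen U) (hT : T2Space U) {f : Y → ℝ}
    (hf : IsBumpOn U f) : f ∈ ccReal Y :=
  Submodule.subset_span ⟨U, hU, hT, hf⟩

theorem ofReal_mem_ccSpan {f : Y → ℝ} (hf : f ∈ ccReal Y) :
    (fun y => (f y : ℂ)) ∈ ccSpan Y := by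
  induction hf using Submodule.span_induction with
  | mem f h =>
    obtain ⟨U, hU, hT, hc, K, hKU, hK, h0⟩ := h
    exact Submodule.subset_span ⟨U, hU, hT, Complex.continuous_ofReal.comp_continuousOn hc, K, hKU,
      hK, fun y hy => by simp [h0 y hy]⟩
  | zero =>
    convert (ccSpan Y).zero_mem using 1
    ext y; simp
  | add f g _ _ hf hg =>
    convert (ccSpan Y).add_mem hf hg using 1
    ext y; simp
  | smul c f _ hf =>
    convert (ccSpan Y).smul_mem (c : ℂ) hf using 1
    ext y; simp

theorem re_im_mem_ccReal {f : Y → ℂ} (hf : f ∈ ccSpan Y) :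
    (fun y => (f y).re) ∈ ccReal Y ∧ (fun y => (f y).im) ∈ ccReal Y := by
  induction hf using Submodule.span_induction with
  | mem f h =>
    obtain ⟨U, hU, hT, hc, K, hKU, hK, h0⟩ := h
    exact ⟨IsBumpOn.mem_ccReal hU hT ⟨Complex.continuous_re.comp_continuousOn hc, K, hKU, hK,
        fun y hy => by simp [h0 y hy]⟩,
      IsBumpOn.mem_ccReal hU hT ⟨Complex.continuous_im.comp_continuousOn hc, K, hKU, hK,
        fun y hy => by simp [h0 y hy]⟩⟩
  | zero => exact ⟨(ccReal Y).zero_mem, (ccReal Y).zero_mem⟩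
  | add f g _ _ hf hg =>
    exact ⟨(ccReal Y).add_mem hf.1 hg.1, (ccReal Y).add_mem hf.2 hg.2⟩
  | smul c f _ hf =>
    refine ⟨?_, ?_⟩
    · convert (ccReal Y).sub_mem ((ccReal Y).smul_mem c.re hf.1) ((ccReal Y).smul_mem c.im hf.2)
        using 1
      ext y; simp
    · convert (ccReal Y).add_mem ((ccReal Y).smul_mem c.re hf.2) ((ccReal Y).smul_mem c.im hf.1)
        using 1
      ext y; simp

theorem ofReal_mem_ccSpan_iff {f : Y → ℝ} :
    (fun y => (f y : ℂ)) ∈ ccSpan Y ↔ f ∈ ccReal Y :=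
  ⟨fun h => (re_im_mem_ccReal h).1, ofReal_mem_ccSpan⟩

theorem exists_isCompact_of_mem_ccReal {f : Y → ℝ} (hf : f ∈ ccReal Y) :
    ∃ K : Set Y, IsCompact K ∧ ∀ y ∉ K, f y = 0 := by
  induction hf using Submodule.span_induction with
  | mem f h =>
    obtain ⟨U, -, -, -, K, -, hK, h0⟩ := h
    exact ⟨K, hK, h0⟩
  | zero => exact ⟨∅, isCompact_empty, fun _ _ => rfl⟩
  | add f g _ _ hf hg =>
    obtain ⟨K, hK, h0⟩ := hf
    obtain ⟨L, hL, h1⟩ := hg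
    exact ⟨K ∪ L, hK.union hL, fun y hy => by
      simp [h0 y fun h => hy (Or.inl h), h1 y fun h => hy (Or.inr h)]⟩
  | smul c f _ hf =>
    obtain ⟨K, hK, h0⟩ := hf
    exact ⟨K, hK, fun y hy => by simp [h0 y hy]⟩

/-- Applied to the fibres `G^x`, which are Hausdorff even if `G` is not: there absolute values stay
in `𝒞_c`. -/
theorem mem_ccReal_iff_of_t2 [T2Space Y] {f : Y → ℝ} :
    f ∈ ccReal Y ↔ Continuous f ∧ HasCompactSupport f := by
  constructor
  · intro hf
    refine ⟨?_, ?_⟩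
    · induction hf using Submodule.span_induction with
      | mem f h =>
        obtain ⟨U, hU, -, hc, K, hKU, hK, h0⟩ := h
        rw [continuous_iff_continuousAt]
        intro y
        by_cases hy : y ∈ K
        · exact hc.continuousAt (hU.mem_nhds (hKU hy))
        · have : f =ᶠ[𝓝 y] fun _ => 0 := by
            filter_upwards [hK.isClosed.isOpen_compl.mem_nhds hy] with z hz using h0 z hz
          exact continuousAt_const.congr this.symm
      | zero => exact continuous_zero
      | add f g _ _ hf hg => exact hf.add hg
      | smul c f _ hf => exact hf.const_smul c
    · obtain ⟨K, hK, h0⟩ := exists_isCompact_of_mem_ccReal hf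
      exact HasCompactSupport.intro hK fun y hy => h0 y hy
  · rintro ⟨hc, hs⟩
    exact IsBumpOn.mem_ccReal isOpen_univ inferInstance ⟨hc.continuousOn, tsupport f,
      Set.subset_univ _, hs, fun y hy => image_eq_zero_of_notMem_tsupport hy⟩

theorem comp_mem_ccReal {j : A → Y} (hj : IsClosedEmbedding j) {f : Y → ℝ} (hf : f ∈ ccReal Y) :
    (fun a => f (j a)) ∈ ccReal A := by
  induction hf using Submodule.span_induction with
  | mem f h =>
    obtain ⟨U, hU, hT, hc, K, hKU, hK, h0⟩ := h
    refine IsBumpOn.mem_ccReal (hU.preimage hj.continuous) ?_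
      ⟨hc.comp hj.continuous.continuousOn fun a ha => ha, j ⁻¹' K, Set.preimage_mono hKU,
        hj.isCompact_preimage hK, fun a ha => h0 _ ha⟩
    exact T2Space.of_injective_continuous (f := U.restrictPreimage j)
      (hj.injective.restrictPreimage U) (hj.continuous.restrictPreimage)
  | zero => exact (ccReal A).zero_mem
  | add f g _ _ hf hg => exact (ccReal A).add_mem hf hg
  | smul c f _ hf => exact (ccReal A).smul_mem c hf

/-- Along an ultrafilter a function in `𝒞_c(Y)` converges to the sum of its values over a finite
set of limits. -/
theorem exists_finset_tendsto_sum {f : Y → ℝ} (hf : f ∈ ccReal Y) (𝒰 : Ultrafilter Y) :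
    ∃ S : Finset Y, (∀ y ∈ S, (𝒰 : Filter Y) ≤ 𝓝 y) ∧ ∀ S' : Finset Y, S ⊆ S' →
      (∀ y ∈ S', (𝒰 : Filter Y) ≤ 𝓝 y) → Tendsto f 𝒰 (𝓝 (∑ y ∈ S', f y)) := by
  classical
  induction hf using Submodule.span_induction with
  | mem f h =>
    obtain ⟨U, hU, hT, hc, K, hKU, hK, h0⟩ := h
    by_cases hKu : K ∈ 𝒰
    · obtain ⟨y, hyK, hy⟩ := hK.ultrafilter_le_nhds 𝒰 (le_principal_iff.2 hKu)
      refine ⟨{y}, by simpa using hy, fun S' hS hS' => ?_⟩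
      have hyS : y ∈ S' := hS (Finset.mem_singleton_self y)
      rw [Finset.sum_eq_single_of_mem y hyS]
      · exact (hc.continuousAt (hU.mem_nhds (hKU hyK))).tendsto.mono_left hy
      -- A limit `z` in `K` would be a second limit inside the Hausdorff set `U`; hence `z` lies off
      -- `K`, where `f` vanishes.
      · intro z hz hzy
        refine h0 z fun hzK => hzy ?_
        have hne : (comap (Subtype.val : U → Y) 𝒰).NeBot := by
          refine comap_neBot fun t ht => ?_
          obtain ⟨w, hwt, hwK⟩ := 𝒰.nonempty_of_mem (inter_mem ht hKu)
          exact ⟨⟨w, hKU hwK⟩, hwt⟩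
        have h1 : comap (Subtype.val : U → Y) 𝒰 ≤ 𝓝 ⟨z, hKU hzK⟩ := by
          rw [nhds_subtype_eq_comap]; exact comap_mono (hS' z hz)
        have h2 : comap (Subtype.val : U → Y) 𝒰 ≤ 𝓝 ⟨y, hKU hyK⟩ := by
          rw [nhds_subtype_eq_comap]; exact comap_mono hy
        exact congrArg Subtype.val (eq_of_nhds_neBot (hne.mono (le_inf h1 h2)))
    · have hev : ∀ᶠ y in (𝒰 : Filter Y), f y = 0 := by
        filter_upwards [Ultrafilter.compl_mem_iff_notMem.2 hKu] with y hy using h0 y hy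
      have hlim : Tendsto f 𝒰 (𝓝 0) :=
        tendsto_const_nhds.congr' (hev.mono fun y hy => hy.symm)
      refine ⟨∅, by simp, fun S' _ hS' => ?_⟩
      rw [Finset.sum_eq_zero]
      · exact hlim
      · intro y hy
        by_cases hyU : y ∈ U
        · exact tendsto_nhds_unique
            ((hc.continuousAt (hU.mem_nhds hyU)).tendsto.mono_left (hS' y hy)) hlim
        · exact h0 y fun h => hyU (hKU h)
  | zero => exact ⟨∅, by simp, fun S' _ _ => by
      simp only [Pi.zero_apply, Finset.sum_const_zero]
      exact tendsto_const_nhds⟩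
  | add f g _ _ hf hg =>
    obtain ⟨S, hS, hf⟩ := hf
    obtain ⟨S₁, hS₁, hg⟩ := hg
    -- The freedom to enlarge the set of limits is what lets the sets of two summands be merged.
    refine ⟨S ∪ S₁, fun y hy => ?_, fun S' hSS hS' => ?_⟩
    · rcases Finset.mem_union.1 hy with h | h
      exacts [hS y h, hS₁ y h]
    · simp only [Pi.add_apply, Finset.sum_add_distrib]
      exact (hf S' (Finset.union_subset_left hSS) hS').add
        (hg S' (Finset.union_subset_right hSS) hS')
  | smul c f _ hf =>
    obtain ⟨S, hS, hf⟩ := hf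
    refine ⟨S, hS, fun S' hSS hS' => ?_⟩
    simp only [Pi.smul_apply, ← Finset.smul_sum]
    exact (hf S' hSS hS').const_smul c

/-- A function in `𝒞_c(Y)` that is non-negative on a fibre is almost non-negative on the nearby
fibres. -/
theorem eventually_fiber_neg_le [T2Space Z] {π : Y → Z} (hπ : Continuous π) {f : Y → ℝ}
    (hf : f ∈ ccReal Y) {z₀ : Z} (h0 : ∀ y, π y = z₀ → 0 ≤ f y) {ε : ℝ} (hε : 0 < ε) :
    ∀ᶠ z in 𝓝 z₀, ∀ y, π y = z → -ε ≤ f y := by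
  by_contra hcon
  have hne : (comap π (𝓝 z₀) ⊓ 𝓟 {y | f y < -ε}).NeBot := by
    rw [inf_principal_neBot_iff]
    intro t ht
    obtain ⟨V, hV, hVt⟩ := mem_comap.1 ht
    by_contra hemp
    refine hcon (mem_of_superset hV fun z hz y hy => ?_)
    by_contra hlt
    exact hemp ⟨y, hVt (show π y ∈ V by rw [hy]; exact hz), not_le.1 hlt⟩
  -- All limits of this ultrafilter lie over `z₀`, so `f` tends along it to a sum of non-negative
  -- values, although `f < -ε` on a member of it.
  let 𝒰 := Ultrafilter.of (comap π (𝓝 z₀) ⊓ 𝓟 {y | f y < -ε})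
  have h𝒰 : (𝒰 : Filter Y) ≤ comap π (𝓝 z₀) ⊓ 𝓟 {y | f y < -ε} := Ultrafilter.of_le _
  obtain ⟨S, hS, hlim⟩ := exists_finset_tendsto_sum hf 𝒰
  have h1 := hlim S subset_rfl hS
  have h2 : ∑ y ∈ S, f y ≤ -ε := le_of_tendsto h1 <| by
    filter_upwards [le_principal_iff.1 (h𝒰.trans inf_le_right)] with y hy using hy.le
  have h3 : 0 ≤ ∑ y ∈ S, f y := Finset.sum_nonneg fun y hy => h0 y <|
    tendsto_nhds_unique (hπ.continuousAt.tendsto.mono_left (hS y hy))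
      (tendsto_comap.mono_left (h𝒰.trans inf_le_left))
  linarith

theorem continuousOn_extend_val {U : Set Y} {φ : U → ℝ} (hφ : Continuous φ) :
    ContinuousOn (Function.extend Subtype.val φ 0) U := by
  rw [continuousOn_iff_continuous_domRestrict]
  convert hφ using 1
  ext u
  exact Subtype.val_injective.extend_apply _ _ _

theorem extend_val_of_notMem {U : Set Y} {φ : U → ℝ} {y : Y}
    (hy : y ∉ (Subtype.val '' tsupport φ : Set Y)) : Function.extend Subtype.val φ 0 y = 0 := by
  by_cases h : ∃ u : U, u.1 = y
  · obtain ⟨u, rfl⟩ := h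
    rw [Subtype.val_injective.extend_apply]
    exact image_eq_zero_of_notMem_tsupport fun h => hy ⟨u, h, rfl⟩
  · rw [Function.extend_apply' _ _ _ h]; rfl

theorem isBumpOn_extend_val {U : Set Y} {φ : U → ℝ} (hφ : Continuous φ)
    (hs : HasCompactSupport φ) : IsBumpOn U (Function.extend Subtype.val φ 0) :=
  ⟨continuousOn_extend_val hφ, Subtype.val '' tsupport φ,
    by rintro _ ⟨u, -, rfl⟩; exact u.2, hs.isCompact.image continuous_subtype_val,
    fun _ hy => extend_val_of_notMem hy⟩

/-- The compact support `K` is closed in the Hausdorff space `V`, though perhaps not in `Y`; so `f`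
vanishes near each point of `V \ K`, relative to `V`. -/
theorem IsBumpOn.mono {U V : Set Y} (hU : IsOpen U) (hUV : U ⊆ V) [T2Space V] {f : Y → ℝ}
    (hf : IsBumpOn U f) : IsBumpOn V f := by
  obtain ⟨hc, K, hKU, hK, h0⟩ := hf
  refine ⟨?_, K, hKU.trans hUV, hK, h0⟩
  intro y hy
  by_cases hyK : y ∈ K
  · exact (hc.continuousAt (hU.mem_nhds (hKU hyK))).continuousWithinAt
  · have hK' : IsCompact ((Subtype.val : V → Y) ⁻¹' K) := by
      rw [IsEmbedding.subtypeVal.isCompact_iff, Subtype.image_preimage_coe,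
        Set.inter_eq_self_of_subset_right (hKU.trans hUV)]
      exact hK
    have h1 : ((Subtype.val : V → Y) ⁻¹' K)ᶜ ∈ 𝓝 (⟨y, hy⟩ : V) :=
      hK'.isClosed.isOpen_compl.mem_nhds hyK
    have h2 : ∀ᶠ z in 𝓝[V] y, z ∉ K := by
      rw [nhdsWithin_eq_map_subtype_coe hy]
      exact h1
    refine (continuousWithinAt_const (b := (0 : ℝ))).congr_of_eventuallyEq ?_ (h0 y hyK)
    filter_upwards [h2] with z hz using h0 z hz

/-- Partition of unity: a bump function is a sum of bump functions subordinate to an open cover. -/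
theorem IsBumpOn.mem_span_of_cover [LocallyCompactSpace Y] {U : Set Y} (hU : IsOpen U)
    [T2Space U] {f : Y → ℝ} (hf : IsBumpOn U f) {ι : Type*} (W : ι → Set Y)
    (hW : ∀ i, IsOpen (W i)) (hcov : U ⊆ ⋃ i, W i) :
    f ∈ Submodule.span ℝ {g : Y → ℝ | ∃ i, IsBumpOn (U ∩ W i) g} := by
  obtain ⟨hc, K, hKU, hK, h0⟩ := hf
  have := hU.locallyCompactSpace
  obtain ⟨t, ht⟩ := hK.elim_finite_subcover W hW (hKU.trans hcov)
  have hK' : IsCompact ((Subtype.val : U → Y) ⁻¹' K) := by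
    rw [IsEmbedding.subtypeVal.isCompact_iff, Subtype.image_preimage_coe,
      Set.inter_eq_self_of_subset_right hKU]
    exact hK
  obtain ⟨φ, hφs, hφ1, -, hφc⟩ := exists_continuous_sum_one_of_isOpen_isCompact
    (s := fun k : Fin t.card => (Subtype.val : U → Y) ⁻¹' W (t.equivFin.symm k))
    (fun k => (hW _).preimage continuous_subtype_val) hK' (by
      intro u hu
      obtain ⟨i, hi, hui⟩ := Set.mem_iUnion₂.1 (ht hu)
      exact Set.mem_iUnion.2 ⟨t.equivFin ⟨i, hi⟩, by simpa using hui⟩)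
  have hsum : f = ∑ k, fun y => Function.extend Subtype.val (φ k) 0 y * f y := by
    ext y
    rw [Finset.sum_apply, ← Finset.sum_mul]
    by_cases hy : y ∈ K
    · have h1 := hφ1 (show (⟨y, hKU hy⟩ : U) ∈ _ from hy)
      have h2 : ∀ k, Function.extend Subtype.val (φ k) 0 y = φ k ⟨y, hKU hy⟩ := fun k =>
        Subtype.val_injective.extend_apply (φ k) 0 (⟨y, hKU hy⟩ : U)
      simp only [Finset.sum_apply, Pi.one_apply] at h1
      simp only [h2, h1, one_mul]
    · rw [h0 y hy, mul_zero]
  rw [hsum]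
  refine Submodule.sum_mem _ fun k _ => Submodule.subset_span ⟨t.equivFin.symm k, ?_⟩
  refine ⟨((continuousOn_extend_val (φ k).continuous).mul hc).mono Set.inter_subset_left,
    Subtype.val '' (tsupport (φ k) ∩ Subtype.val ⁻¹' K), ?_, ?_, ?_⟩
  · rintro _ ⟨u, hu, rfl⟩
    exact ⟨u.2, hφs k hu.1⟩
  · exact ((hφc k).isCompact.inter_right hK'.isClosed).image continuous_subtype_val
  · intro y hy
    by_cases hyK : y ∈ K
    · beta_reduce
      rw [extend_val_of_notMem, zero_mul]
      rintro ⟨u, hu, rfl⟩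
      exact hy ⟨u, ⟨hu, hyK⟩, rfl⟩
    · beta_reduce
      rw [h0 y hyK, mul_zero]

/-- Tietze extension for compactly supported functions. -/
theorem exists_extension_hasCompactSupport [T2Space Y] [LocallyCompactSpace Y] {j : A → Y}
    (hj : IsClosedEmbedding j) {f : A → ℝ} (hf : Continuous f) (hs : HasCompactSupport f) :
    ∃ F : Y → ℝ, Continuous F ∧ HasCompactSupport F ∧ ∀ a, F (j a) = f a := by
  have hK : IsCompact (j '' tsupport f) := hs.isCompact.image hj.continuous
  obtain ⟨N, hN, hKN⟩ := exists_compact_superset hK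
  have : CompactSpace N := isCompact_iff_compactSpace.1 hN
  -- Tietze is used on the compact, hence normal, neighbourhood `N`. The cut-off `χ` vanishes off
  -- `N' ⊆ interior N`, which makes the extension by zero continuous.
  obtain ⟨F, hF⟩ := ContinuousMap.exists_extension (hj.restrictPreimage N)
    ⟨fun a : j ⁻¹' N => f a, hf.comp continuous_subtype_val⟩
  obtain ⟨N', hN', hN'c, hN's⟩ : ∃ N' : Set Y, N' ⊆ interior N ∧ IsClosed N' ∧
      j '' tsupport f ⊆ interior N' := by
    obtain ⟨N', h1, h2, h3⟩ := exists_compact_between hK isOpen_interior hKN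
    exact ⟨N', h3, h1.isClosed, h2⟩
  obtain ⟨χ, hχ1, hχ0, -, -⟩ := exists_continuous_one_zero_of_isCompact hK
    isOpen_interior.isClosed_compl (Set.disjoint_compl_right_iff_subset.2 hN's)
  have hχN : ∀ y ∉ N', χ y = 0 := fun y hy => hχ0 fun h => hy (interior_subset h)
  refine ⟨fun y => χ y * Function.extend Subtype.val F 0 y, ?_, ?_, ?_⟩
  · rw [continuous_iff_continuousAt]
    intro y
    by_cases hy : y ∈ N'
    · exact χ.continuous.continuousAt.mul ((continuousOn_extend_val F.continuous).continuousAt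
        (mem_interior_iff_mem_nhds.1 (hN' hy)))
    · refine (continuousAt_const (y := (0 : ℝ))).congr ?_
      filter_upwards [hN'c.isOpen_compl.mem_nhds hy] with z hz
      rw [hχN z hz, zero_mul]
  · refine HasCompactSupport.intro hN fun y hy => ?_
    rw [hχN y fun h => hy (interior_subset (hN' h)), zero_mul]
  · intro a
    beta_reduce
    by_cases ha : a ∈ tsupport f
    · have haN : j a ∈ N := interior_subset (hKN ⟨a, ha, rfl⟩)
      have h1 := DFunLike.congr_fun hF ⟨a, haN⟩
      have h2 : Function.extend Subtype.val F 0 (j a) = F ⟨j a, haN⟩ :=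
        Subtype.val_injective.extend_apply F 0 (⟨j a, haN⟩ : N)
      rw [h2, hχ1 ⟨a, ha, rfl⟩]
      simpa using h1
    · rw [image_eq_zero_of_notMem_tsupport ha]
      by_cases haN : j a ∈ N
      · have h1 := DFunLike.congr_fun hF ⟨a, haN⟩
        have h2 : Function.extend Subtype.val F 0 (j a) = F ⟨j a, haN⟩ :=
          Subtype.val_injective.extend_apply F 0 (⟨j a, haN⟩ : N)
        have h3 : F ⟨j a, haN⟩ = f a := h1
        rw [h2, h3, image_eq_zero_of_notMem_tsupport ha, mul_zero]
      · rw [hχN _ fun h => haN (interior_subset (hN' h)), zero_mul]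

/-- Functions in `𝒞_c` extend from closed subspaces. -/
theorem exists_extension_mem_ccReal (hY : IsLocallyCompactSpace Y) {j : A → Y}
    (hj : IsClosedEmbedding j) {f : A → ℝ} (hf : f ∈ ccReal A) :
    ∃ F ∈ ccReal Y, ∀ a, F (j a) = f a := by
  have hYlc := hY.locallyCompactSpace
  have hAlc := hj.locallyCompactSpace
  suffices h : ccReal A ≤ (ccReal Y).map (LinearMap.funLeft ℝ ℝ j) by
    obtain ⟨F, hF, hFf⟩ := h hf
    exact ⟨F, hF, fun a => congrFun hFf a⟩
  refine Submodule.span_le.2 ?_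
  rintro f ⟨U, hU, hT, hf⟩
  -- A bump function is split into pieces subordinate to the traces of the Hausdorff charts of `Y`.
  -- Each piece then extends within a single chart.
  choose W hWo hyW hWT using hY.exists_open_t2
  have h1 := hf.mem_span_of_cover hU (fun y => j ⁻¹' W y)
    (fun y => (hWo y).preimage hj.continuous)
    fun a _ => Set.mem_iUnion.2 ⟨j a, hyW (j a)⟩
  refine Submodule.span_le.2 ?_ h1
  rintro g ⟨y, hg⟩
  have hT' : T2Space (j ⁻¹' W y) := T2Space.of_injective_continuous
    (f := (W y).restrictPreimage j) (hj.injective.restrictPreimage _)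
    hj.continuous.restrictPreimage
  obtain ⟨hc, K, hKU, hK, h0⟩ :=
    hg.mono (hU.inter ((hWo y).preimage hj.continuous)) Set.inter_subset_right
  have hlc : LocallyCompactSpace (W y) := (hWo y).locallyCompactSpace
  obtain ⟨F, hFc, hFs, hF⟩ := exists_extension_hasCompactSupport (hj.restrictPreimage (W y))
    (f := fun a : j ⁻¹' W y => g a) (continuousOn_iff_continuous_domRestrict.1 hc) (by
      refine HasCompactSupport.intro (K := Subtype.val ⁻¹' K) ?_ fun a ha => h0 _ ha
      rw [IsEmbedding.subtypeVal.isCompact_iff, Subtype.image_preimage_coe,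
        Set.inter_eq_self_of_subset_right hKU]
      exact hK)
  refine ⟨Function.extend Subtype.val F 0,
    IsBumpOn.mem_ccReal (hWo y) (hWT y) (isBumpOn_extend_val hFc hFs), ?_⟩
  ext a
  change Function.extend Subtype.val F 0 (j a) = g a
  by_cases ha : j a ∈ W y
  · have h2 : Function.extend Subtype.val F 0 (j a) = F ⟨j a, ha⟩ :=
      Subtype.val_injective.extend_apply F 0 (⟨j a, ha⟩ : W y)
    rw [h2]
    exact hF ⟨a, ha⟩
  · rw [h0 a fun h => ha (hKU h), Function.extend_apply']
    · rfl
    · rintro ⟨u, hu⟩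
      exact ha (hu ▸ u.2)

/-- Local bump functions are added over a finite cover. Truncating the sum could leave `𝒞_c`, so no
upper bound is claimed. -/
theorem exists_mem_ccReal_one_le (hY : IsLocallyCompactSpace Y) {K : Set Y} (hK : IsCompact K) :
    ∃ h ∈ ccReal Y, (∀ y, 0 ≤ h y) ∧ ∀ y ∈ K, 1 ≤ h y := by
  have := hY.locallyCompactSpace
  refine hK.induction_on (p := fun K => ∃ h ∈ ccReal Y, (∀ y, 0 ≤ h y) ∧ ∀ y ∈ K, 1 ≤ h y)
    ?_ ?_ ?_ ?_
  · exact ⟨0, (ccReal Y).zero_mem, fun _ => le_rfl, by simp⟩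
  · rintro s t hst ⟨h, h1, h2, h3⟩
    exact ⟨h, h1, h2, fun y hy => h3 y (hst hy)⟩
  · rintro s t ⟨h, h1, h2, h3⟩ ⟨k, k1, k2, k3⟩
    refine ⟨h + k, (ccReal Y).add_mem h1 k1, fun y => add_nonneg (h2 y) (k2 y), ?_⟩
    rintro y (hy | hy)
    · exact (h3 y hy).trans (le_add_of_nonneg_right (k2 y))
    · exact (k3 y hy).trans (le_add_of_nonneg_left (h2 y))
  · intro y hy
    obtain ⟨U, hU, hyU, hT⟩ := hY.exists_open_t2 y
    have := hU.locallyCompactSpace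
    obtain ⟨N, hN, hyN⟩ := exists_compact_mem_nhds (⟨y, hyU⟩ : U)
    obtain ⟨χ, hχ1, -, hχs, hχ⟩ := exists_continuous_one_zero_of_isCompact hN
      isClosed_empty (Set.disjoint_empty _)
    refine ⟨Subtype.val '' N, mem_nhdsWithin_of_mem_nhds ?_, Function.extend Subtype.val χ 0,
      IsBumpOn.mem_ccReal hU hT (isBumpOn_extend_val χ.continuous hχs), fun z => ?_, ?_⟩
    · exact hU.isOpenMap_subtype_val.image_mem_nhds hyN
    · by_cases h : ∃ u : U, u.1 = z
      · obtain ⟨u, rfl⟩ := h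
        rw [Subtype.val_injective.extend_apply]
        exact (hχ u).1
      · rw [Function.extend_apply' _ _ _ h]; rfl
    · rintro _ ⟨u, hu, rfl⟩
      rw [Subtype.val_injective.extend_apply, hχ1 hu]; rfl

end CompactlySupported

/-! ### Fibres, pullbacks and semicontinuity of fibrewise integrals -/

namespace TopGroupoid

variable {G X Z : Type*} [TopologicalSpace G] [TopologicalSpace X] [TopologicalSpace Z]

section Algebra

variable (𝒢 : TopGroupoid G X)

theorem mul_eq_of_eq_unit {u b : G} (hu : 𝒢.s u = 𝒢.r b) (h : u = 𝒢.unit (𝒢.r b)) :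
    𝒢.mul u b hu = b := by
  subst h
  exact 𝒢.unit_mul b

theorem mul_eq_of_unit_eq {a u : G} (hu : 𝒢.s a = 𝒢.r u) (h : u = 𝒢.unit (𝒢.s a)) :
    𝒢.mul a u hu = a := by
  subst h
  exact 𝒢.mul_unit a

theorem inv_mul_cancel_left (a b : G) (h : 𝒢.s a = 𝒢.r b)
    (h' : 𝒢.s (𝒢.inv a) = 𝒢.r (𝒢.mul a b h)) : 𝒢.mul (𝒢.inv a) (𝒢.mul a b h) h' = b := by
  rw [← 𝒢.mul_assoc (𝒢.inv a) a b (𝒢.s_inv a) h]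
  exact 𝒢.mul_eq_of_eq_unit _ ((𝒢.inv_mul a).trans (congrArg 𝒢.unit h))

theorem mul_inv_cancel_left (a b : G) (h : 𝒢.s (𝒢.inv a) = 𝒢.r b)
    (h' : 𝒢.s a = 𝒢.r (𝒢.mul (𝒢.inv a) b h)) : 𝒢.mul a (𝒢.mul (𝒢.inv a) b h) h' = b := by
  rw [← 𝒢.mul_assoc a (𝒢.inv a) b (𝒢.r_inv a).symm h]
  exact 𝒢.mul_eq_of_eq_unit _
    ((𝒢.mul_inv a).trans (congrArg 𝒢.unit ((𝒢.s_inv a).symm.trans h)))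

theorem eq_of_mul_inv_eq_unit {a b : G} (h : 𝒢.s a = 𝒢.r (𝒢.inv b))
    (hu : 𝒢.mul a (𝒢.inv b) h = 𝒢.unit (𝒢.r b)) : a = b := by
  have h1 := 𝒢.mul_assoc a (𝒢.inv b) b h (𝒢.s_inv b)
  rw [𝒢.mul_eq_of_eq_unit _ hu, 𝒢.mul_eq_of_unit_eq] at h1
  · exact h1.symm
  · rw [𝒢.inv_mul, h, 𝒢.r_inv]

end Algebra

/-- If an ultrafilter on `G^x` tends to both `a` and `b`, the constant `γ γ⁻¹ = unit x` tends to `a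
b⁻¹`. Constants have a unique limit in a `T₁` space, so `a b⁻¹` is a unit and `a = b`. -/
theorem fiber_t2Space (𝒢 : TopGroupoid G X) (hG : IsLocallyCompactSpace G) (x : X) :
    T2Space (𝒢.Fiber x) := by
  have := hG.t1Space
  have := 𝒢.t2Space_units
  rw [t2_iff_ultrafilter]
  intro a b 𝒰 ha hb
  have hca : Tendsto (fun c : 𝒢.Fiber x => c.1) 𝒰 (𝓝 a.1) :=
    (continuous_subtype_val.tendsto a).mono_left ha
  have hcb : Tendsto (fun c : 𝒢.Fiber x => c.1) 𝒰 (𝓝 b.1) :=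
    (continuous_subtype_val.tendsto b).mono_left hb
  have hs : 𝒢.s a.1 = 𝒢.s b.1 := tendsto_nhds_unique
    ((𝒢.continuous_s.tendsto _).comp hca) ((𝒢.continuous_s.tendsto _).comp hcb)
  have hlim : Tendsto (fun c : 𝒢.Fiber x =>
      (⟨(c.1, 𝒢.inv c.1), (𝒢.r_inv _).symm⟩ : {q : G × G // 𝒢.s q.1 = 𝒢.r q.2})) 𝒰
      (𝓝 ⟨(a.1, 𝒢.inv b.1), hs.trans (𝒢.r_inv _).symm⟩) := by
    rw [tendsto_subtype_rng]
    exact hca.prodMk_nhds ((𝒢.continuous_inv.tendsto _).comp hcb)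
  have h1 := (𝒢.continuous_mul.tendsto _).comp hlim
  have h2 : Tendsto (fun _ : 𝒢.Fiber x => 𝒢.unit x) 𝒰
      (𝓝 (𝒢.mul a.1 (𝒢.inv b.1) (hs.trans (𝒢.r_inv _).symm))) := by
    refine h1.congr fun c => ?_
    have := 𝒢.mul_inv c.1
    rw [c.2] at this
    exact this
  rw [tendsto_const_nhds_iff] at h2
  refine Subtype.ext (𝒢.eq_of_mul_inv_eq_unit _ (h2.symm.trans ?_))
  rw [b.2]

theorem isClosedEmbedding_fiber (𝒢 : TopGroupoid G X) (x : X) :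
    IsClosedEmbedding fun γ : 𝒢.Fiber x => γ.1 := by
  have := 𝒢.t2Space_units
  have h : IsClosed {γ | 𝒢.r γ = x} := isClosed_singleton.preimage 𝒢.continuous_r
  exact h.isClosedEmbedding_subtypeVal

/-- The space `Z ×_X G` of pairs `(z, γ)` with `ρ z = r γ`. -/
abbrev Pullback (𝒢 : TopGroupoid G X) (ρ : Z → X) : Type _ := {q : Z × G // ρ q.1 = 𝒢.r q.2}

theorem isClosed_pullback (𝒢 : TopGroupoid G X) {ρ : Z → X} (hρ : Continuous ρ) :
    IsClosed {q : Z × G | ρ q.1 = 𝒢.r q.2} := by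
  have := 𝒢.t2Space_units
  exact isClosed_eq (hρ.comp continuous_fst) (𝒢.continuous_r.comp continuous_snd)

theorem isClosedEmbedding_pullback_fiber [T1Space Z] (𝒢 : TopGroupoid G X) (ρ : Z → X) (z : Z) :
    IsClosedEmbedding fun γ : 𝒢.Fiber (ρ z) => (⟨(z, γ.1), γ.2.symm⟩ : 𝒢.Pullback ρ) := by
  refine ⟨IsEmbedding.of_comp (g := fun q : 𝒢.Pullback ρ => q.1.2)
    ((continuous_const.prodMk continuous_subtype_val).subtype_mk _)
    (continuous_snd.comp continuous_subtype_val) IsEmbedding.subtypeVal, ?_⟩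
  convert (isClosed_singleton (x := z)).preimage
    (continuous_fst.comp continuous_subtype_val : Continuous fun q : 𝒢.Pullback ρ => q.1.1) using 1
  ext ⟨⟨w, γ⟩, h⟩
  constructor
  · rintro ⟨δ, hδ⟩
    exact (congrArg (fun q : 𝒢.Pullback ρ => q.1.1) hδ).symm
  · rintro rfl
    exact ⟨⟨γ, h.symm⟩, rfl⟩

/-- The part of the pullback over a Hausdorff chart `U` injects continuously into the Hausdorff
space `Z × U`; `χ` supplies compactness in the direction of `Z`. -/
theorem mul_mem_ccReal_pullback [T2Space Z] (𝒢 : TopGroupoid G X) {ρ : Z → X}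
    (hρ : Continuous ρ) {χ : Z → ℝ} (hχ : Continuous χ) (hχs : HasCompactSupport χ) {f : G → ℝ}
    (hf : f ∈ ccReal G) : (fun q : 𝒢.Pullback ρ => χ q.1.1 * f q.1.2) ∈ ccReal (𝒢.Pullback ρ) := by
  induction hf using Submodule.span_induction with
  | mem f h =>
    obtain ⟨U, hU, hT, hc, K, hKU, hK, h0⟩ := h
    have hfst : Continuous fun q : 𝒢.Pullback ρ => q.1.1 :=
      continuous_fst.comp continuous_subtype_val
    have hsnd : Continuous fun q : 𝒢.Pullback ρ => q.1.2 :=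
      continuous_snd.comp continuous_subtype_val
    refine IsBumpOn.mem_ccReal (U := {q : 𝒢.Pullback ρ | q.1.2 ∈ U}) (hU.preimage hsnd) ?_ ⟨?_,
      {q | q.1.1 ∈ tsupport χ ∧ q.1.2 ∈ K}, fun q hq => hKU hq.2, ?_, ?_⟩
    · refine T2Space.of_injective_continuous
        (f := fun q : {q : 𝒢.Pullback ρ | q.1.2 ∈ U} => (q.1.1.1, (⟨q.1.1.2, q.2⟩ : U))) ?_ ?_
      · intro q q' h
        have h1 := congrArg Prod.fst h
        have h2 := congrArg Subtype.val (congrArg Prod.snd h)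
        exact Subtype.ext (Subtype.ext (Prod.ext h1 h2))
      · exact (hfst.comp continuous_subtype_val).prodMk
          ((hsnd.comp continuous_subtype_val).subtype_mk _)
    · exact (hχ.comp hfst).continuousOn.mul (hc.comp hsnd.continuousOn fun q hq => hq)
    · exact (𝒢.isClosed_pullback hρ).isClosedEmbedding_subtypeVal.isCompact_preimage
        (hχs.isCompact.prod hK)
    · intro q hq
      beta_reduce
      by_cases h : q.1.2 ∈ K
      · rw [image_eq_zero_of_notMem_tsupport fun h' => hq ⟨h', h⟩, zero_mul]
      · rw [h0 _ h, mul_zero]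
  | zero =>
    convert (ccReal (𝒢.Pullback ρ)).zero_mem using 1
    ext q; simp
  | add f g _ _ hf hg =>
    convert (ccReal (𝒢.Pullback ρ)).add_mem hf hg using 1
    ext q; simp [mul_add]
  | smul c f _ hf =>
    convert (ccReal (𝒢.Pullback ρ)).smul_mem c hf using 1
    ext q; simp [mul_left_comm]

variable {𝒢 : TopGroupoid G X}

theorem fiber_continuous (hG : IsLocallyCompactSpace G) {f : G → ℝ} (hf : f ∈ ccReal G) (x : X) :
    Continuous (fun γ : 𝒢.Fiber x => f γ.1) ∧ HasCompactSupport (fun γ : 𝒢.Fiber x => f γ.1) :=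
  have := 𝒢.fiber_t2Space hG x
  mem_ccReal_iff_of_t2.1 (comp_mem_ccReal (𝒢.isClosedEmbedding_fiber x) hf)

theorem integrable_fiber (hG : IsLocallyCompactSpace G) {f : G → ℝ} (hf : f ∈ ccReal G) {x : X}
    (μ : Measure (𝒢.Fiber x)) [IsFiniteMeasureOnCompacts μ] :
    Integrable (fun γ : 𝒢.Fiber x => f γ.1) μ :=
  (fiber_continuous hG hf x).1.integrable_of_hasCompactSupport (fiber_continuous hG hf x).2

theorem pullback_fiber_continuous [T1Space Z] (hG : IsLocallyCompactSpace G) {ρ : Z → X}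
    {F : 𝒢.Pullback ρ → ℝ} (hF : F ∈ ccReal (𝒢.Pullback ρ)) (z : Z) :
    Continuous (fun γ : 𝒢.Fiber (ρ z) => F ⟨(z, γ.1), γ.2.symm⟩) ∧
      HasCompactSupport (fun γ : 𝒢.Fiber (ρ z) => F ⟨(z, γ.1), γ.2.symm⟩) :=
  have := 𝒢.fiber_t2Space hG (ρ z)
  mem_ccReal_iff_of_t2.1 (comp_mem_ccReal (𝒢.isClosedEmbedding_pullback_fiber ρ z) hF)

theorem integrable_pullback_fiber [T1Space Z] (hG : IsLocallyCompactSpace G) {ρ : Z → X}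
    {F : 𝒢.Pullback ρ → ℝ} (hF : F ∈ ccReal (𝒢.Pullback ρ)) (z : Z)
    (μ : Measure (𝒢.Fiber (ρ z))) [IsFiniteMeasureOnCompacts μ] :
    Integrable (fun γ : 𝒢.Fiber (ρ z) => F ⟨(z, γ.1), γ.2.symm⟩) μ :=
  (pullback_fiber_continuous hG hF z).1.integrable_of_hasCompactSupport
    (pullback_fiber_continuous hG hF z).2

/-- Upper semicontinuity of the fibrewise `L¹`-norm. -/
theorem eventually_integral_abs_lt (hG : IsLocallyCompactSpace G)
    {μ : (x : X) → Measure (𝒢.Fiber x)} [∀ x, IsFiniteMeasureOnCompacts (μ x)]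
    (hμ : ∀ f ∈ ccReal G, Continuous fun x => ∫ γ, f γ.1 ∂(μ x))
    [T2Space Z] [LocallyCompactSpace Z] {ρ : Z → X} (hρ : Continuous ρ)
    {F : 𝒢.Pullback ρ → ℝ} (hF : F ∈ ccReal (𝒢.Pullback ρ)) {z₀ : Z} {c : ℝ}
    (hc : ∫ γ : 𝒢.Fiber (ρ z₀), |F ⟨(z₀, γ.1), γ.2.symm⟩| ∂(μ (ρ z₀)) < c) :
    ∀ᶠ z in 𝓝 z₀, ∫ γ : 𝒢.Fiber (ρ z), |F ⟨(z, γ.1), γ.2.symm⟩| ∂(μ (ρ z)) < c := by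
  have := 𝒢.fiber_t2Space hG (ρ z₀)
  obtain ⟨hF1, hF2⟩ := pullback_fiber_continuous hG hF z₀
  -- `|F|` may fail to lie in `𝒞_c` of the pullback, but its restriction to the Hausdorff fibre over
  -- `z₀` does lie in `𝒞_c` of that fibre, and so extends to `h` on `G`.
  obtain ⟨h, hh, hhF⟩ := exists_extension_mem_ccReal hG (𝒢.isClosedEmbedding_fiber (ρ z₀))
    (mem_ccReal_iff_of_t2.2 ⟨hF1.abs, hF2.comp_left (g := fun t => |t|) abs_zero⟩)
  obtain ⟨χ, hχ1, -, hχs, hχ⟩ := exists_continuous_one_zero_of_isCompact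
    (isCompact_singleton (x := z₀)) isClosed_empty (Set.disjoint_empty _)
  have hχz : χ z₀ = 1 := hχ1 rfl
  have hχh := 𝒢.mul_mem_ccReal_pullback hρ χ.continuous hχs hh
  obtain ⟨K, hK, hK0⟩ := exists_isCompact_of_mem_ccReal hF
  obtain ⟨K', hK', hK0'⟩ := exists_isCompact_of_mem_ccReal hχh
  have hsnd : Continuous fun q : 𝒢.Pullback ρ => q.1.2 :=
    continuous_snd.comp continuous_subtype_val
  obtain ⟨k, hk, hk0, hk1⟩ := exists_mem_ccReal_one_le hG ((hK.union hK').image hsnd)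
  have hfst : Continuous fun q : 𝒢.Pullback ρ => q.1.1 :=
    continuous_fst.comp continuous_subtype_val
  have hfib : ∀ q : 𝒢.Pullback ρ, q.1.1 = z₀ → |F q| = χ q.1.1 * h q.1.2 := by
    rintro ⟨⟨z, γ⟩, hq⟩ (rfl : z = z₀)
    have := hhF ⟨γ, hq.symm⟩
    simp only at this ⊢
    rw [hχz, one_mul, this]
  have hk' := hμ k hk
  have hh' := hμ h hh
  set a := ∫ γ : 𝒢.Fiber (ρ z₀), |F ⟨(z₀, γ.1), γ.2.symm⟩| ∂(μ (ρ z₀)) with ha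
  have ha' : ∫ γ : 𝒢.Fiber (ρ z₀), h γ.1 ∂(μ (ρ z₀)) = a :=
    integral_congr_ae (Eventually.of_forall hhF)
  obtain ⟨ε, hε, hεc⟩ : ∃ ε > 0, a + ε * ∫ γ : 𝒢.Fiber (ρ z₀), k γ.1 ∂(μ (ρ z₀)) < c := by
    have hlim : Tendsto (fun ε : ℝ => a + ε * ∫ γ : 𝒢.Fiber (ρ z₀), k γ.1 ∂(μ (ρ z₀)))
        (𝓝[>] 0) (𝓝 (a + 0 * ∫ γ : 𝒢.Fiber (ρ z₀), k γ.1 ∂(μ (ρ z₀)))) :=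
      (Continuous.tendsto (by fun_prop) 0).mono_left nhdsWithin_le_nhds
    rw [zero_mul, add_zero] at hlim
    obtain ⟨ε, h1, h2⟩ := ((hlim.eventually (gt_mem_nhds hc)).and self_mem_nhdsWithin).exists
    exact ⟨ε, h2, h1⟩
  -- Over `z₀` both `χ h - F` and `χ h + F` are non-negative, so `|F| ≤ χ h + ε` on nearby fibres.
  -- As both sides are supported in `K ∪ K'`, the constant `ε` can be replaced by the integrable `ε
  -- k`.
  have hlow := eventually_fiber_neg_le hfst ((ccReal _).sub_mem hχh hF) (z₀ := z₀) (fun q hq => by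
    simp only [Pi.sub_apply, ← hfib q hq]
    exact sub_nonneg.2 (le_abs_self _)) hε
  have hupp := eventually_fiber_neg_le hfst ((ccReal _).add_mem hχh hF) (z₀ := z₀) (fun q hq => by
    simp only [Pi.add_apply, ← hfib q hq]
    linarith [neg_abs_le (F q)]) hε
  have hcont : Tendsto (fun z => χ z * (∫ γ : 𝒢.Fiber (ρ z), h γ.1 ∂(μ (ρ z)))
      + ε * ∫ γ : 𝒢.Fiber (ρ z), k γ.1 ∂(μ (ρ z))) (𝓝 z₀)
      (𝓝 (a + ε * ∫ γ : 𝒢.Fiber (ρ z₀), k γ.1 ∂(μ (ρ z₀)))) := by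
    have h1 : Continuous fun z => χ z * (∫ γ : 𝒢.Fiber (ρ z), h γ.1 ∂(μ (ρ z)))
      + ε * ∫ γ : 𝒢.Fiber (ρ z), k γ.1 ∂(μ (ρ z)) :=
      (χ.continuous.mul (hh'.comp hρ)).add (continuous_const.mul (hk'.comp hρ))
    have h2 := h1.tendsto z₀
    rwa [hχz, one_mul, ha'] at h2
  filter_upwards [hlow, hupp, hcont.eventually (gt_mem_nhds hεc)] with z h1 h2 h3
  refine lt_of_le_of_lt ?_ h3
  have i1 := integrable_fiber hG hh (μ (ρ z))
  have i2 := integrable_fiber hG hk (μ (ρ z))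
  rw [← integral_const_mul, ← integral_const_mul, ← integral_add (i1.const_mul _) (i2.const_mul _)]
  refine integral_mono (integrable_pullback_fiber hG hF z (μ (ρ z))).abs
    ((i1.const_mul _).add (i2.const_mul _)) fun γ => ?_
  have e1 := h1 ⟨(z, γ.1), γ.2.symm⟩ rfl
  have e2 := h2 ⟨(z, γ.1), γ.2.symm⟩ rfl
  simp only [Pi.sub_apply, Pi.add_apply] at e1 e2 ⊢
  by_cases hq : (⟨(z, γ.1), γ.2.symm⟩ : 𝒢.Pullback ρ) ∈ K ∪ K'
  · have e3 := hk1 γ.1 ⟨_, hq, rfl⟩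
    have e4 : ε ≤ ε * k γ.1 := le_mul_of_one_le_right hε.le e3
    rw [abs_le]
    constructor <;> linarith
  · have e5 := hK0' _ fun h => hq (Or.inr h)
    simp only at e5
    rw [hK0 _ fun h => hq (Or.inl h), e5, abs_zero, zero_add]
    exact mul_nonneg hε.le (hk0 _)

/-- Continuity of fibrewise integrals. -/
theorem continuous_integral_pullback (hG : IsLocallyCompactSpace G)
    {μ : (x : X) → Measure (𝒢.Fiber x)} [∀ x, IsFiniteMeasureOnCompacts (μ x)]
    (hμ : ∀ f ∈ ccReal G, Continuous fun x => ∫ γ, f γ.1 ∂(μ x))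
    [T2Space Z] [LocallyCompactSpace Z] {ρ : Z → X} (hρ : Continuous ρ)
    {F : 𝒢.Pullback ρ → ℝ} (hF : F ∈ ccReal (𝒢.Pullback ρ)) :
    Continuous fun z => ∫ γ : 𝒢.Fiber (ρ z), F ⟨(z, γ.1), γ.2.symm⟩ ∂(μ (ρ z)) := by
  rw [continuous_iff_continuousAt]
  intro z₀
  have := 𝒢.fiber_t2Space hG (ρ z₀)
  obtain ⟨h, hh, hhF⟩ := exists_extension_mem_ccReal hG (𝒢.isClosedEmbedding_fiber (ρ z₀))
    (mem_ccReal_iff_of_t2.2 (pullback_fiber_continuous hG hF z₀))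
  obtain ⟨χ, hχ1, -, hχs, hχ⟩ := exists_continuous_one_zero_of_isCompact
    (isCompact_singleton (x := z₀)) isClosed_empty (Set.disjoint_empty _)
  have hχz : χ z₀ = 1 := hχ1 rfl
  have hχh := 𝒢.mul_mem_ccReal_pullback hρ χ.continuous hχs hh
  have hdiff := (ccReal _).sub_mem hF hχh
  have hcont : Continuous fun z => χ z * ∫ γ : 𝒢.Fiber (ρ z), h γ.1 ∂(μ (ρ z)) :=
    χ.continuous.mul ((hμ h hh).comp hρ)
  have h0 : χ z₀ * ∫ γ : 𝒢.Fiber (ρ z₀), h γ.1 ∂(μ (ρ z₀)) =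
      ∫ γ : 𝒢.Fiber (ρ z₀), F ⟨(z₀, γ.1), γ.2.symm⟩ ∂(μ (ρ z₀)) := by
    rw [hχz, one_mul]
    exact integral_congr_ae (Eventually.of_forall hhF)
  rw [ContinuousAt, ← h0]
  -- `F - χ h` vanishes over `z₀`, so semicontinuity forces its fibrewise `L¹`-norm to tend to zero.
  have hz : Tendsto (fun z => (∫ γ : 𝒢.Fiber (ρ z), F ⟨(z, γ.1), γ.2.symm⟩ ∂(μ (ρ z))) -
      χ z * ∫ γ : 𝒢.Fiber (ρ z), h γ.1 ∂(μ (ρ z))) (𝓝 z₀) (𝓝 0) := by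
    rw [Metric.tendsto_nhds]
    intro ε hε
    have := eventually_integral_abs_lt hG hμ hρ hdiff (z₀ := z₀) (c := ε) (by
      convert hε using 1
      refine integral_eq_zero_of_ae (Eventually.of_forall fun γ => ?_)
      have := hhF γ
      simp only [Pi.sub_apply, Pi.zero_apply, hχz, one_mul] at this ⊢
      rw [this, sub_self, abs_zero])
    filter_upwards [this] with z hz
    rw [dist_zero_right, Real.norm_eq_abs, ← integral_const_mul,
      ← integral_sub (integrable_pullback_fiber hG hF z _)
        ((integrable_fiber hG hh _).const_mul _)]
    exact (abs_integral_le_integral_abs).trans_lt hz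
  simpa using hz.add (hcont.tendsto z₀)

end TopGroupoid

/-- The points of `Q` near which `P` does not hold throughout form a compact set, whose image in `Z`
is closed and misses `z₀`. -/
theorem IsCompact.eventually_fiber {Y Z : Type*} [TopologicalSpace Y] [TopologicalSpace Z]
    [T2Space Z] {π : Y → Z} (hπ : Continuous π) {Q : Set Y} (hQ : IsCompact Q) {P : Y → Prop}
    {z₀ : Z} (h : ∀ y ∈ Q, π y = z₀ → ∀ᶠ y' in 𝓝 y, P y') :
    ∀ᶠ z in 𝓝 z₀, ∀ y ∈ Q, π y = z → P y := by
  have hW : IsOpen {y | ∀ᶠ y' in 𝓝 y, P y'} := isOpen_setOfPred_eventually_nhds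
  have hc : IsClosed (π '' (Q \ {y | ∀ᶠ y' in 𝓝 y, P y'})) := ((hQ.diff hW).image hπ).isClosed
  have hz : z₀ ∉ π '' (Q \ {y | ∀ᶠ y' in 𝓝 y, P y'}) := by
    rintro ⟨y, ⟨hyQ, hy⟩, rfl⟩
    exact hy (h y hyQ rfl)
  filter_upwards [hc.isOpen_compl.mem_nhds hz] with z hz y hyQ hyz
  by_contra hP
  exact hz ⟨y, ⟨hyQ, fun h' => hP h'.self_of_nhds⟩, hyz⟩

theorem mul_continuous_mem_ccReal {Y : Type*} [TopologicalSpace Y] {ψ : Y → ℝ}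
    (hψ : Continuous ψ) {f : Y → ℝ} (hf : f ∈ ccReal Y) : (fun y => ψ y * f y) ∈ ccReal Y := by
  induction hf using Submodule.span_induction with
  | mem f h =>
    obtain ⟨U, hU, hT, hc, K, hKU, hK, h0⟩ := h
    exact IsBumpOn.mem_ccReal hU hT ⟨hψ.continuousOn.mul hc, K, hKU, hK, fun y hy => by
      simp [h0 y hy]⟩
  | zero =>
    convert (ccReal Y).zero_mem using 1
    ext q; simp
  | add f g _ _ hf hg =>
    convert (ccReal Y).add_mem hf hg using 1
    ext q; simp [mul_add]
  | smul c f _ hf =>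
    convert (ccReal Y).smul_mem c hf using 1
    ext q; simp [mul_left_comm]

/-! ### Translations, the translation defect and reductions -/

namespace TopGroupoid

variable {G X T Z : Type*} [TopologicalSpace G] [TopologicalSpace X] [TopologicalSpace T]
  [TopologicalSpace Z]

/-- Left translation as a homeomorphism. -/
def translateHomeomorph (𝒢 : TopGroupoid G X) (γ : G) : 𝒢.Fiber (𝒢.s γ) ≃ₜ 𝒢.Fiber (𝒢.r γ) where
  toFun := 𝒢.translate γ
  invFun γ₁ := ⟨𝒢.mul (𝒢.inv γ) γ₁.1 ((𝒢.s_inv γ).trans γ₁.2.symm),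
    (𝒢.r_mul _ _ _).trans (𝒢.r_inv γ)⟩
  left_inv γ₁ := Subtype.ext (𝒢.inv_mul_cancel_left γ γ₁.1 _ _)
  right_inv γ₁ := Subtype.ext (𝒢.mul_inv_cancel_left γ γ₁.1 _ _)
  continuous_toFun := 𝒢.continuous_translate γ
  continuous_invFun := (𝒢.continuous_mul.comp
    (f := fun γ₁ : 𝒢.Fiber (𝒢.r γ) =>
      (⟨(𝒢.inv γ, γ₁.1), (𝒢.s_inv γ).trans γ₁.2.symm⟩ : {q : G × G // 𝒢.s q.1 = 𝒢.r q.2}))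
    (Continuous.subtype_mk (continuous_const.prodMk continuous_subtype_val) _)).subtype_mk _

/-- The homeomorphism `(z, γ₁) ↦ (z, ρ(z)⁻¹ γ₁)`. -/
def pullbackInvMul (𝒢 : TopGroupoid G X) {ρ : Z → G} (hρ : Continuous ρ) :
    𝒢.Pullback (fun z => 𝒢.r (ρ z)) ≃ₜ 𝒢.Pullback (fun z => 𝒢.s (ρ z)) where
  toFun q := ⟨(q.1.1, 𝒢.mul (𝒢.inv (ρ q.1.1)) q.1.2 ((𝒢.s_inv _).trans q.2)),
    ((𝒢.r_mul _ _ _).trans (𝒢.r_inv _)).symm⟩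
  invFun q := ⟨(q.1.1, 𝒢.mul (ρ q.1.1) q.1.2 q.2), (𝒢.r_mul _ _ _).symm⟩
  left_inv q := Subtype.ext (Prod.ext rfl (𝒢.mul_inv_cancel_left _ _ _ _))
  right_inv q := Subtype.ext (Prod.ext rfl (𝒢.inv_mul_cancel_left _ _ _ _))
  continuous_toFun := by
    have h1 : Continuous fun q : 𝒢.Pullback (fun z => 𝒢.r (ρ z)) => q.1.1 :=
      continuous_fst.comp continuous_subtype_val
    have h2 : Continuous fun q : 𝒢.Pullback (fun z => 𝒢.r (ρ z)) => q.1.2 :=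
      continuous_snd.comp continuous_subtype_val
    exact (h1.prodMk (𝒢.continuous_mul.comp
      (f := fun q : 𝒢.Pullback (fun z => 𝒢.r (ρ z)) =>
        (⟨(𝒢.inv (ρ q.1.1), q.1.2), (𝒢.s_inv _).trans q.2⟩ : {q : G × G // 𝒢.s q.1 = 𝒢.r q.2}))
      (((𝒢.continuous_inv.comp (hρ.comp h1)).prodMk h2).subtype_mk _))).subtype_mk _
  continuous_invFun := by
    have h1 : Continuous fun q : 𝒢.Pullback (fun z => 𝒢.s (ρ z)) => q.1.1 :=
      continuous_fst.comp continuous_subtype_val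
    have h2 : Continuous fun q : 𝒢.Pullback (fun z => 𝒢.s (ρ z)) => q.1.2 :=
      continuous_snd.comp continuous_subtype_val
    exact (h1.prodMk (𝒢.continuous_mul.comp
      (f := fun q : 𝒢.Pullback (fun z => 𝒢.s (ρ z)) =>
        (⟨(ρ q.1.1, q.1.2), q.2⟩ : {q : G × G // 𝒢.s q.1 = 𝒢.r q.2}))
      (((hρ.comp h1).prodMk h2).subtype_mk _))).subtype_mk _

/-- The integral `∫ |g(γ⁻¹ γ₁) - g(γ₁)| dλ^{r(γ)}(γ₁)`. -/
noncomputable def translationDefect (𝒢 : TopGroupoid G X) (lam : (x : X) → Measure (𝒢.Fiber x))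
    (g : G → ℝ) (γ : G) : ℝ :=
  ∫ γ₁ : 𝒢.Fiber (𝒢.r γ),
    |g (𝒢.mul (𝒢.inv γ) γ₁.1 ((𝒢.s_inv γ).trans γ₁.2.symm)) - g γ₁.1| ∂(lam (𝒢.r γ))

variable {𝒢 : TopGroupoid G X} {lam : (x : X) → Measure (𝒢.Fiber x)}

theorem continuous_integral_ccReal_of_ccSpan {μ : (x : X) → Measure (𝒢.Fiber x)}
    (hμ : ∀ f ∈ ccSpan G, Continuous fun x => ∫ γ, f γ.1 ∂(μ x)) {f : G → ℝ}
    (hf : f ∈ ccReal G) : Continuous fun x => ∫ γ, f γ.1 ∂(μ x) := by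
  have h := Complex.continuous_re.comp (hμ _ (ofReal_mem_ccSpan hf))
  refine h.congr fun x => ?_
  simp only [Function.comp_apply]
  rw [integral_complex_ofReal, Complex.ofReal_re]

theorem continuous_integral_ccSpan_of_ccReal (hG : IsLocallyCompactSpace G)
    {μ : (x : X) → Measure (𝒢.Fiber x)} [∀ x, IsFiniteMeasureOnCompacts (μ x)]
    (hμ : ∀ f ∈ ccReal G, Continuous fun x => ∫ γ, f γ.1 ∂(μ x)) {f : G → ℂ}
    (hf : f ∈ ccSpan G) : Continuous fun x => ∫ γ, f γ.1 ∂(μ x) := by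
  obtain ⟨h1, h2⟩ := re_im_mem_ccReal hf
  have h : Continuous fun x => ((∫ γ, (f γ.1).re ∂(μ x) : ℝ) : ℂ) +
      ((∫ γ, (f γ.1).im ∂(μ x) : ℝ) : ℂ) * Complex.I :=
    (Complex.continuous_ofReal.comp (hμ _ h1)).add
      ((Complex.continuous_ofReal.comp (hμ _ h2)).mul continuous_const)
  refine h.congr fun x => ?_
  rw [← integral_complex_ofReal, ← integral_complex_ofReal, ← integral_mul_const, ← integral_add
    (integrable_fiber hG h1 (μ x)).ofReal ((integrable_fiber hG h2 (μ x)).ofReal.mul_const _)]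
  simp only [Complex.re_add_im]

theorem IsHaarSystem.isFiniteMeasureOnCompacts (hlam : 𝒢.IsHaarSystem lam) (x : X) :
    IsFiniteMeasureOnCompacts (lam x) :=
  have := hlam.regular x
  inferInstance

theorem IsHaarSystem.continuous_integral (hlam : 𝒢.IsHaarSystem lam) {f : G → ℝ}
    (hf : f ∈ ccReal G) : Continuous fun x => ∫ γ, f γ.1 ∂(lam x) :=
  continuous_integral_ccReal_of_ccSpan hlam.continuous hf

theorem IsHaarSystem.integral_inv_mul (hlam : 𝒢.IsHaarSystem lam) (f : G → ℝ) (γ : G) :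
    ∫ γ₁ : 𝒢.Fiber (𝒢.r γ), f (𝒢.mul (𝒢.inv γ) γ₁.1 ((𝒢.s_inv γ).trans γ₁.2.symm))
      ∂(lam (𝒢.r γ)) = ∫ γ₁ : 𝒢.Fiber (𝒢.s γ), f γ₁.1 ∂(lam (𝒢.s γ)) := by
  rw [← hlam.invariant γ]
  refine ((𝒢.translateHomeomorph γ).measurableEmbedding.integral_map _).trans ?_
  refine integral_congr_ae (Eventually.of_forall fun γ₁ => ?_)
  exact congrArg f (𝒢.inv_mul_cancel_left γ γ₁.1 _ _)

theorem integrable_inv_mul (hG : IsLocallyCompactSpace G) {f : G → ℝ} (hf : f ∈ ccReal G) (γ : G)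
    (μ : Measure (𝒢.Fiber (𝒢.r γ))) [IsFiniteMeasureOnCompacts μ] :
    Integrable (fun γ₁ : 𝒢.Fiber (𝒢.r γ) =>
      f (𝒢.mul (𝒢.inv γ) γ₁.1 ((𝒢.s_inv γ).trans γ₁.2.symm))) μ := by
  obtain ⟨h1, h2⟩ := fiber_continuous (𝒢 := 𝒢) hG hf (𝒢.s γ)
  exact (h1.comp (𝒢.translateHomeomorph γ).symm.continuous).integrable_of_hasCompactSupport
    (h2.comp_homeomorph (𝒢.translateHomeomorph γ).symm)

theorem IsHaarSystem.translationDefect_le (hlam : 𝒢.IsHaarSystem lam)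
    (hG : IsLocallyCompactSpace G) {k : G → ℝ} (hk : k ∈ ccReal G) (hk0 : ∀ γ, 0 ≤ k γ) (γ : G) :
    𝒢.translationDefect lam k γ ≤
      (∫ γ₁, k γ₁.1 ∂(lam (𝒢.s γ))) + ∫ γ₁, k γ₁.1 ∂(lam (𝒢.r γ)) := by
  have := hlam.isFiniteMeasureOnCompacts
  have i1 := integrable_inv_mul hG hk γ (lam (𝒢.r γ))
  have i2 := integrable_fiber hG hk (lam (𝒢.r γ))
  rw [← hlam.integral_inv_mul k γ, ← integral_add i1 i2]
  refine integral_mono (i1.sub i2).abs (i1.add i2) fun γ₁ => ?_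
  refine (abs_sub _ _).trans ?_
  simp only [abs_of_nonneg (hk0 _), le_refl]

/-- The identity for `g` is required only over the two endpoints of `γ`. The constants `c` may thus
be the values at one orbit of coefficients that vary over the unit space. -/
theorem IsHaarSystem.translationDefect_le_sum (hlam : 𝒢.IsHaarSystem lam)
    (hG : IsLocallyCompactSpace G) {ι : Type*} (S : Finset ι) (c : ι → ℝ) (f : ι → G → ℝ)
    (hf : ∀ i ∈ S, f i ∈ ccReal G) (hc : ∀ i ∈ S, 0 ≤ c i) (g : G → ℝ) (γ : G)
    (hg : ∀ γ₁, 𝒢.r γ₁ = 𝒢.r γ ∨ 𝒢.r γ₁ = 𝒢.s γ → g γ₁ = ∑ i ∈ S, c i * f i γ₁) :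
    𝒢.translationDefect lam g γ ≤ ∑ i ∈ S, c i * 𝒢.translationDefect lam (f i) γ := by
  have := hlam.isFiniteMeasureOnCompacts
  have hi : ∀ i ∈ S, Integrable (fun γ₁ : 𝒢.Fiber (𝒢.r γ) =>
      c i * |f i (𝒢.mul (𝒢.inv γ) γ₁.1 ((𝒢.s_inv γ).trans γ₁.2.symm)) - f i γ₁.1|)
      (lam (𝒢.r γ)) := fun i hi =>
    ((integrable_inv_mul hG (hf i hi) γ _).sub (integrable_fiber hG (hf i hi) _)).abs.const_mul _
  simp only [translationDefect, ← integral_const_mul]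
  rw [← integral_finsetSum S hi]
  refine integral_mono_of_nonneg (Eventually.of_forall fun _ => abs_nonneg _)
    (integrable_finsetSum S hi) (Eventually.of_forall fun γ₁ => ?_)
  beta_reduce
  rw [hg γ₁.1 (Or.inl γ₁.2), hg _ (Or.inr ((𝒢.r_mul _ _ _).trans (𝒢.r_inv γ))),
    ← Finset.sum_sub_distrib]
  refine (Finset.abs_sum_le_sum_abs _ _).trans (Finset.sum_le_sum fun i hi => ?_)
  rw [← mul_sub, abs_mul, abs_of_nonneg (hc i hi)]

/-- Over a Hausdorff chart around `γ₀`, the defect is the fibrewise `L¹`-norm of a function on the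
pullback along `r`, whose translated term is carried over from the pullback along `s` by
`pullbackInvMul`. Upper semicontinuity applies after a cut-off equal to one near `γ₀`. -/
theorem IsHaarSystem.eventually_translationDefect_lt (hlam : 𝒢.IsHaarSystem lam)
    (hG : IsLocallyCompactSpace G) {g : G → ℝ} (hg : g ∈ ccReal G) {γ₀ : G} {c : ℝ}
    (hc : 𝒢.translationDefect lam g γ₀ < c) :
    ∀ᶠ γ in 𝓝 γ₀, 𝒢.translationDefect lam g γ < c := by
  have := hlam.isFiniteMeasureOnCompacts
  have := hG.locallyCompactSpace
  obtain ⟨U, hU, hγU, hT⟩ := hG.exists_open_t2 γ₀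
  have := hU.locallyCompactSpace
  obtain ⟨N, hN, hγN⟩ := exists_compact_mem_nhds (⟨γ₀, hγU⟩ : U)
  obtain ⟨χ, hχ1, -, hχs, hχ⟩ := exists_continuous_one_zero_of_isCompact hN
    isClosed_empty (Set.disjoint_empty _)
  have hval : Continuous fun z : U => z.1 := continuous_subtype_val
  have h1 := 𝒢.mul_mem_ccReal_pullback (𝒢.continuous_r.comp hval) χ.continuous hχs hg
  have h2 := comp_mem_ccReal (𝒢.pullbackInvMul hval).isClosedEmbedding
    (𝒢.mul_mem_ccReal_pullback (𝒢.continuous_s.comp hval) χ.continuous hχs hg)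
  let F : 𝒢.Pullback (fun z : U => 𝒢.r z.1) → ℝ := fun q =>
    χ q.1.1 * g (𝒢.mul (𝒢.inv q.1.1.1) q.1.2 ((𝒢.s_inv _).trans q.2)) - χ q.1.1 * g q.1.2
  have hF : F ∈ ccReal _ := (ccReal _).sub_mem h2 h1
  have key : ∀ z : U, z ∈ N → 𝒢.translationDefect lam g z.1 =
      ∫ γ : 𝒢.Fiber (𝒢.r z.1), |F ⟨(z, γ.1), γ.2.symm⟩| ∂(lam (𝒢.r z.1)) := by
    intro z hz
    refine integral_congr_ae (Eventually.of_forall fun γ => ?_)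
    have hz1 : χ z = 1 := hχ1 hz
    simp only [F, hz1, one_mul]
  have h4 := eventually_integral_abs_lt hG (fun f hf => hlam.continuous_integral hf)
    (𝒢.continuous_r.comp hval) hF (z₀ := ⟨γ₀, hγU⟩) (c := c)
    (by rw [key ⟨γ₀, hγU⟩ (mem_of_mem_nhds hγN)] at hc; exact hc)
  have h5 : ∀ᶠ z : U in 𝓝 ⟨γ₀, hγU⟩, 𝒢.translationDefect lam g z.1 < c := by
    filter_upwards [h4, hγN] with z hz hzN
    rw [key z hzN]
    exact hz
  have h6 := hU.isOpenMap_subtype_val.image_mem_nhds h5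
  filter_upwards [h6]
  rintro _ ⟨z, hz, rfl⟩
  exact hz

theorem IsHaarSystem.exists_integral_le (hlam : 𝒢.IsHaarSystem lam)
    {k : G → ℝ} (hk : k ∈ ccReal G) : ∃ C, 0 ≤ C ∧ ∀ x, ∫ γ, k γ.1 ∂(lam x) ≤ C := by
  obtain ⟨K, hK, hK0⟩ := exists_isCompact_of_mem_ccReal hk
  obtain ⟨C, hC⟩ := ((hK.image 𝒢.continuous_r).image (hlam.continuous_integral hk)).bddAbove
  refine ⟨max C 0, le_max_right _ _, fun x => ?_⟩
  by_cases hx : x ∈ 𝒢.r '' K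
  · exact (hC ⟨x, hx, rfl⟩).trans (le_max_left _ _)
  · refine le_trans (le_of_eq ?_) (le_max_right _ _)
    exact integral_eq_zero_of_ae (Eventually.of_forall fun γ => hK0 _ fun h => hx ⟨_, h, γ.2⟩)

/-- Take `K = E n`, `L = r(E n)` and `ε = 1/(n+1)` along a compact exhaustion. Any compact set of
units ends up in `r(E n)`, since its image under `unit` is compact in `G`. -/
theorem hasApproxInvariantDensity_of_forall_isCompact (hG : IsLocallyCompactSpace G)
    [SigmaCompactSpace G]
    (h : ∀ K : Set G, IsCompact K → ∀ L : Set X, IsCompact L → ∀ ε > 0, ∃ g ∈ ccReal G,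
      (∀ γ, 0 ≤ g γ) ∧ (∀ x, ∫ γ, g γ.1 ∂(lam x) ≤ 1) ∧ (∀ x ∈ L, 1 - ε ≤ ∫ γ, g γ.1 ∂(lam x)) ∧
      ∀ γ ∈ K, 𝒢.translationDefect lam g γ ≤ ε) :
    𝒢.HasApproxInvariantDensity lam := by
  have := hG.locallyCompactSpace
  let E : CompactExhaustion G := default
  have hε : ∀ n : ℕ, (0 : ℝ) < 1 / ((n : ℝ) + 1) := fun n => by positivity
  choose g hg hg0 hg1 hgL hgK using fun n : ℕ => h (E n) (E.isCompact n) (𝒢.r '' E n)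
    ((E.isCompact n).image 𝒢.continuous_r) _ (hε n)
  have hsmall : ∀ ε > (0 : ℝ), ∀ N : ℕ, ∀ᶠ n : ℕ in atTop, N ≤ n ∧ 1 / ((n : ℝ) + 1) < ε :=
    fun ε hε N => (eventually_ge_atTop N).and
      ((tendsto_one_div_add_atTop_nhds_zero_nat (𝕜 := ℝ)).eventually (gt_mem_nhds hε))
  refine ⟨g, fun n => ofReal_mem_ccSpan (hg n), hg0, hg1, fun L hL => ?_, fun K hK => ?_⟩
  · obtain ⟨N, hN⟩ := E.exists_superset_of_isCompact (hL.image 𝒢.isEmbedding_unit.continuous)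
    rw [Metric.tendstoUniformlyOn_iff]
    intro ε hε
    filter_upwards [hsmall ε hε N] with n hn x hx
    have h1 := hgL n x ⟨𝒢.unit x, E.subset hn.1 (hN ⟨x, hx, rfl⟩), 𝒢.r_unit x⟩
    have h2 := hg1 n x
    rw [Real.dist_eq, abs_of_nonneg (by linarith)]
    linarith [hn.2]
  · obtain ⟨N, hN⟩ := E.exists_superset_of_isCompact hK
    rw [Metric.tendstoUniformlyOn_iff]
    intro ε hε
    filter_upwards [hsmall ε hε N] with n hn γ hγ
    have h1 := hgK n γ (E.subset hn.1 (hN hγ))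
    rw [dist_comm, dist_zero_right, Real.norm_eq_abs, abs_of_nonneg]
    · exact h1.trans_lt hn.2
    · exact integral_nonneg fun _ => abs_nonneg _

theorem HasApproxInvariantDensity.exists_approx (h : 𝒢.HasApproxInvariantDensity lam) {K : Set G}
    (hK : IsCompact K) {L : Set X} (hL : IsCompact L) {ε : ℝ} (hε : 0 < ε) :
    ∃ g ∈ ccReal G,
      (∀ γ, 0 ≤ g γ) ∧ (∀ x, ∫ γ, g γ.1 ∂(lam x) ≤ 1) ∧ (∀ x ∈ L, 1 - ε < ∫ γ, g γ.1 ∂(lam x)) ∧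
      ∀ γ ∈ K, 𝒢.translationDefect lam g γ < ε := by
  obtain ⟨g, hg, hg0, hg1, hgL, hgK⟩ := h
  have h1 := Metric.tendstoUniformlyOn_iff.1 (hgL L hL) ε hε
  have h2 := Metric.tendstoUniformlyOn_iff.1 (hgK K hK) ε hε
  obtain ⟨n, h1, h2⟩ := (h1.and h2).exists
  refine ⟨g n, ofReal_mem_ccSpan_iff.1 (hg n), hg0 n, hg1 n, fun x hx => ?_, fun γ hγ => ?_⟩
  · have := (abs_lt.1 ((Real.dist_eq _ _).symm.trans_lt (h1 x hx))).2
    linarith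
  · have := h2 γ hγ
    rw [dist_comm, dist_zero_right, Real.norm_eq_abs] at this
    exact (le_abs_self _).trans_lt this

/-! ### Reductions to closed invariant sets -/

section Reduction

variable {A : Set X} {hA : ∀ γ, 𝒢.r γ ∈ A ↔ 𝒢.s γ ∈ A}

theorem isClosedEmbedding_redArrows (𝒢 : TopGroupoid G X) {A : Set X} (hAc : IsClosed A) :
    IsClosedEmbedding (Subtype.val : 𝒢.RedArrows A → G) :=
  ((hAc.preimage 𝒢.continuous_r).inter (hAc.preimage 𝒢.continuous_s)).isClosedEmbedding_subtypeVal

theorem integral_restrictSystem (x : A) (f : (𝒢.reduction A hA).Fiber x → ℝ) :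
    ∫ γ, f γ ∂(𝒢.restrictSystem lam A hA x) = ∫ γ, f (𝒢.fiberToReduction A hA x γ) ∂(lam x.1) :=
  (𝒢.fiberToReduction A hA x).measurableEmbedding.integral_map _

theorem translationDefect_reduction (g : G → ℝ) (γ : 𝒢.RedArrows A) :
    (𝒢.reduction A hA).translationDefect (𝒢.restrictSystem lam A hA) (fun γ => g γ.1) γ =
      𝒢.translationDefect lam g γ.1 :=
  integral_restrictSystem (lam := lam) (hA := hA) ((𝒢.reduction A hA).r γ) _

theorem HasApproxInvariantDensity.reduction (hAc : IsClosed A)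
    (h : 𝒢.HasApproxInvariantDensity lam) :
    (𝒢.reduction A hA).HasApproxInvariantDensity (𝒢.restrictSystem lam A hA) := by
  obtain ⟨g, hg, hg0, hg1, hgL, hgK⟩ := h
  refine ⟨fun n γ => g n γ.1, fun n => ?_, fun n γ => hg0 n _, fun n x => ?_, fun L hL => ?_,
    fun K hK => ?_⟩
  · exact ofReal_mem_ccSpan (comp_mem_ccReal (𝒢.isClosedEmbedding_redArrows hAc)
      (ofReal_mem_ccSpan_iff.1 (hg n)))
  · rw [integral_restrictSystem]
    exact hg1 n x.1
  · refine (((hgL _ (hL.image continuous_subtype_val)).comp Subtype.val).mono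
      (Set.subset_preimage_image _ _)).congr (Eventually.of_forall fun n x _ => ?_)
    exact (integral_restrictSystem (lam := lam) (hA := hA) x fun γ => g n γ.1.1).symm
  · refine (((hgK _ (hK.image continuous_subtype_val)).comp Subtype.val).mono
      (Set.subset_preimage_image _ _)).congr (Eventually.of_forall fun n γ _ => ?_)
    exact (translationDefect_reduction (lam := lam) (hA := hA) (g n) γ).symm

end Reduction

end TopGroupoid

/-- A partition of unity on a compact set, with sum at most one everywhere. -/
theorem IsCompact.exists_partition_le_one {T : Type*} [TopologicalSpace T] [T2Space T]
    [LocallyCompactSpace T] {n : ℕ} {Q : Set T} (hQ : IsCompact Q) {V : Fin n → Set T}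
    (hV : ∀ i, IsOpen (V i)) (hQV : Q ⊆ ⋃ i, V i) :
    ∃ φ : Fin n → T → ℝ, (∀ i, Continuous (φ i)) ∧ (∀ i t, 0 ≤ φ i t) ∧
      (∀ i, ∀ t ∉ V i, φ i t = 0) ∧ (∀ t, ∑ i, φ i t ≤ 1) ∧ ∀ t ∈ Q, ∑ i, φ i t = 1 := by
  obtain ⟨f, hfs, hf1, hf, -⟩ := exists_continuous_sum_one_of_isOpen_isCompact hV hQ hQV
  -- The sum of the `f i` is one on `Q` but uncontrolled elsewhere; dividing by its maximum with one
  -- caps it without changing it on `Q`.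
  have hpos : ∀ t, (0 : ℝ) < max 1 (∑ i, f i t) := fun t => zero_lt_one.trans_le (le_max_left _ _)
  refine ⟨fun i t => f i t / max 1 (∑ i, f i t), fun i => ?_, fun i t =>
    div_nonneg (hf i t).1 (hpos t).le, fun i t ht => ?_, fun t => ?_, fun t ht => ?_⟩
  · exact (f i).continuous.div (continuous_const.max
      (continuous_finsetSum _ fun i _ => (f i).continuous)) fun t => (hpos t).ne'
  · beta_reduce
    rw [image_eq_zero_of_notMem_tsupport fun h => ht (hfs i h), zero_div]
  · rw [← Finset.sum_div, div_le_one (hpos t)]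
    exact le_max_right _ _
  · have h1 := hf1 ht
    simp only [Finset.sum_apply, Pi.one_apply] at h1
    rw [← Finset.sum_div, h1, max_self, div_one]

/-! ### Gluing densities over the base `T` -/

namespace TopGroupoid

variable {G X T : Type*} [TopologicalSpace G] [TopologicalSpace X] [TopologicalSpace T]
  {𝒢 : TopGroupoid G X} {lam : (x : X) → Measure (𝒢.Fiber x)}

/-- An approximately invariant density on one fibre `G(t)` extends to a function on `G` that is
approximately invariant on all nearby fibres. -/
theorem exists_approx_near_fiber [T2Space T] (hG : IsLocallyCompactSpace G)
    (hlam : 𝒢.IsHaarSystem lam) {p : X → T} (hp : 𝒢.IsGroupoidBundle p) (t : T)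
    (h : (𝒢.bundleFiber hp t).HasApproxInvariantDensity (𝒢.bundleFiberSystem lam hp t))
    {K : Set G} (hK : IsCompact K) {L : Set X} (hL : IsCompact L) {ε : ℝ} (hε : 0 < ε) :
    ∃ g ∈ ccReal G, ∀ᶠ u in 𝓝 t, (∀ γ, p (𝒢.r γ) = u → 0 ≤ g γ) ∧
      (∀ x, p x = u → ∫ γ, g γ.1 ∂(lam x) ≤ 1) ∧
      (∀ x ∈ L, p x = u → 1 - ε ≤ ∫ γ, g γ.1 ∂(lam x)) ∧
      ∀ γ ∈ K, p (𝒢.r γ) = u → 𝒢.translationDefect lam g γ ≤ ε := by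
  have := hlam.isFiniteMeasureOnCompacts
  obtain ⟨η, hη, hηε⟩ : ∃ η > 0, 4 * η = ε := ⟨ε / 4, by positivity, by ring⟩
  have hAc : IsClosed (p ⁻¹' {t}) := isClosed_singleton.preimage hp.continuous
  have hpr : Continuous fun γ => p (𝒢.r γ) := hp.continuous.comp 𝒢.continuous_r
  have hj := 𝒢.isClosedEmbedding_redArrows hAc
  obtain ⟨g₀, hg₀, hg₀0, hg₀1, hg₀L, hg₀K⟩ := h.exists_approx (hj.isCompact_preimage hK)
    (hAc.isClosedEmbedding_subtypeVal.isCompact_preimage hL) hη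
  obtain ⟨g, hg, hgg₀⟩ := exists_extension_mem_ccReal hG hj hg₀
  obtain rfl : (fun γ : 𝒢.RedArrows (p ⁻¹' {t}) => g γ.1) = g₀ := funext hgg₀
  have hint : ∀ x : p ⁻¹' {t}, ∫ γ, g γ.1.1 ∂(𝒢.bundleFiberSystem lam hp t x) =
      ∫ γ, g γ.1 ∂(lam x.1) := fun x => integral_restrictSystem x fun γ => g γ.1.1
  obtain ⟨Q, hQ, hQ0⟩ := exists_isCompact_of_mem_ccReal hg
  obtain ⟨k, hk, hk0, hk1⟩ := exists_mem_ccReal_one_le hG hQ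
  obtain ⟨C, hC, hkC⟩ := hlam.exists_integral_le hk
  obtain ⟨δ, hδ, hδC⟩ : ∃ δ > 0, δ * C ≤ η :=
    ⟨η / (C + 1), by positivity, by rw [div_mul_eq_mul_div, div_le_iff₀ (by positivity)]; nlinarith⟩
  have hc := hlam.continuous_integral hg
  have e1 := eventually_fiber_neg_le hpr hg (z₀ := t) (fun γ hγ =>
    hg₀0 ⟨γ, hγ, (hp.invariant γ).symm.trans hγ⟩) hδ
  -- Off the compact set `r(Q)` the integral vanishes, so only `r(Q)` needs a uniform neighbourhood
  -- of `t`.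
  have e2 : ∀ᶠ u in 𝓝 t, ∀ x ∈ 𝒢.r '' Q, p x = u → ∫ γ, g γ.1 ∂(lam x) < 1 + η := by
    refine (hQ.image 𝒢.continuous_r).eventually_fiber hp.continuous fun x _ hx => ?_
    refine (hc.tendsto x).eventually (gt_mem_nhds ?_)
    rw [← hint ⟨x, hx⟩]
    exact (hg₀1 ⟨x, hx⟩).trans_lt (by linarith)
  have e3 : ∀ᶠ u in 𝓝 t, ∀ x ∈ L, p x = u → 1 - η < ∫ γ, g γ.1 ∂(lam x) := by
    refine hL.eventually_fiber hp.continuous fun x hxL hx => ?_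
    refine (hc.tendsto x).eventually (lt_mem_nhds ?_)
    rw [← hint ⟨x, hx⟩]
    exact hg₀L ⟨x, hx⟩ hxL
  have e4 : ∀ᶠ u in 𝓝 t, ∀ γ ∈ K, p (𝒢.r γ) = u → 𝒢.translationDefect lam g γ < η := by
    refine hK.eventually_fiber hpr fun γ hγK hγ => ?_
    refine hlam.eventually_translationDefect_lt hG hg ?_
    have h1 := hg₀K ⟨γ, hγ, (hp.invariant γ).symm.trans hγ⟩ hγK
    exact (translationDefect_reduction (lam := lam) (hA := hp.preimage_invariant t) g
      ⟨γ, hγ, (hp.invariant γ).symm.trans hγ⟩).symm.trans_lt h1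
  -- Since `g ≥ -δ` nearby and `k ≥ 1` on the support `Q`, adding `δ k` restores positivity, at a
  -- cost of `δ C ≤ η` in mass. The total is then at most `1 + 2η`, hence the divisor.
  have hD : 0 < 1 + 2 * η := by positivity
  have hg' : ∀ x, ∫ γ : 𝒢.Fiber x, (1 + 2 * η)⁻¹ * (g γ.1 + δ * k γ.1) ∂(lam x) =
      (1 + 2 * η)⁻¹ * ((∫ γ, g γ.1 ∂(lam x)) + δ * ∫ γ, k γ.1 ∂(lam x)) := fun x => by
    rw [integral_const_mul, integral_add (integrable_fiber hG hg _)
      ((integrable_fiber hG hk _).const_mul _), integral_const_mul]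
  have hkx0 : ∀ x, 0 ≤ ∫ γ, k γ.1 ∂(lam x) := fun x => integral_nonneg fun γ => hk0 γ.1
  refine ⟨fun γ => (1 + 2 * η)⁻¹ * (g γ + δ * k γ),
    (ccReal G).smul_mem (1 + 2 * η)⁻¹ ((ccReal G).add_mem hg ((ccReal G).smul_mem δ hk)), ?_⟩
  filter_upwards [e1, e2, e3, e4] with u e1 e2 e3 e4
  refine ⟨fun γ hγ => mul_nonneg (inv_nonneg.2 hD.le) ?_, fun x hx => ?_, fun x hxL hx => ?_,
    fun γ hγK hγ => ?_⟩
  · by_cases hγQ : γ ∈ Q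
    · have := le_mul_of_one_le_right hδ.le (hk1 γ hγQ)
      linarith [e1 γ hγ]
    · rw [hQ0 γ hγQ, zero_add]
      exact mul_nonneg hδ.le (hk0 γ)
  · rw [hg', inv_mul_le_iff₀ hD, mul_one]
    have h1 := (mul_le_mul_of_nonneg_left (hkC x) hδ.le).trans hδC
    by_cases hxQ : x ∈ 𝒢.r '' Q
    · linarith [e2 x hxQ hx]
    · have h0 : ∫ γ, g γ.1 ∂(lam x) = 0 := integral_eq_zero_of_ae
        (Eventually.of_forall fun γ => hQ0 _ fun h => hxQ ⟨_, h, γ.2⟩)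
      linarith
  · rw [hg', le_inv_mul_iff₀ hD]
    have h1 := e3 x hxL hx
    have h2 := mul_nonneg hδ.le (hkx0 x)
    nlinarith
  -- Before rescaling, `g` contributes at most `η` and `δ k` at most `2 δ C ≤ 2η`, together below `ε
  -- = 4η`.
  · have h1 := hlam.translationDefect_le_sum hG Finset.univ
      (![(1 + 2 * η)⁻¹, (1 + 2 * η)⁻¹ * δ]) (![g, k])
      (by simp [Fin.forall_fin_two, hg, hk])
      (by simp only [Finset.mem_univ, Fin.forall_fin_two, Matrix.cons_val_zero,
            Matrix.cons_val_one, forall_const]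
          constructor <;> positivity)
      (fun γ => (1 + 2 * η)⁻¹ * (g γ + δ * k γ)) γ
      (fun γ₁ _ => by simp [Fin.sum_univ_two]; ring)
    simp only [Fin.sum_univ_two, Matrix.cons_val_zero, Matrix.cons_val_one] at h1
    have h2 := hlam.translationDefect_le hG hk hk0 γ
    have h3 := e4 γ hγK hγ
    have h4 := mul_le_mul_of_nonneg_left (h2.trans (add_le_add (hkC _) (hkC _))) hδ.le
    refine h1.trans ?_
    rw [_root_.mul_assoc, ← mul_add, inv_mul_le_iff₀ hD]
    nlinarith

/-- On each `G(u)` the glued function is a fixed combination of local densities: the weights `φ i (p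
(r γ))` are constant there. They sum to at most one, and to exactly one over the compact set that
carries the estimates. -/
theorem hasApproxInvariantDensity_of_bundleFiber [T2Space T] [LocallyCompactSpace T]
    (hG : IsLocallyCompactSpace G) [SigmaCompactSpace G] (hlam : 𝒢.IsHaarSystem lam) {p : X → T}
    (hp : 𝒢.IsGroupoidBundle p)
    (h : ∀ t, (𝒢.bundleFiber hp t).HasApproxInvariantDensity (𝒢.bundleFiberSystem lam hp t)) :
    𝒢.HasApproxInvariantDensity lam := by
  have := hlam.isFiniteMeasureOnCompacts
  refine hasApproxInvariantDensity_of_forall_isCompact hG fun K hK L hL ε hε => ?_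
  choose g hg hgt using fun t => exists_approx_near_fiber hG hlam hp t (h t) hK hL hε
  have hQ : IsCompact (p '' (L ∪ 𝒢.r '' K)) :=
    (hL.union (hK.image 𝒢.continuous_r)).image hp.continuous
  choose V hVP hVo hVt using fun t => eventually_nhds_iff.1 (hgt t)
  obtain ⟨S, -, hS⟩ := hQ.elim_nhds_subcover V fun t _ => (hVo t).mem_nhds (hVt t)
  let e := S.equivFin
  obtain ⟨φ, hφ, hφ0, hφV, hφ1, hφQ⟩ := hQ.exists_partition_le_one
    (V := fun i : Fin S.card => V (e.symm i).1) (fun i => hVo _) (fun t ht => by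
      obtain ⟨s, hs, hts⟩ := Set.mem_iUnion₂.1 (hS ht)
      exact Set.mem_iUnion.2 ⟨e ⟨s, hs⟩, by simpa using hts⟩)
  -- A nonzero weight at `u` places `u` in `V i`, where all four estimates hold for the `i`-th
  -- function.
  have hV := fun i u (hi : φ i u ≠ 0) => hVP _ _ (not_imp_comm.1 (hφV i u) hi)
  let f : Fin S.card → G → ℝ := fun i => g (e.symm i).1
  have hfcc : ∀ i, f i ∈ ccReal G := fun i => hg _
  have hpr : Continuous fun γ => p (𝒢.r γ) := hp.continuous.comp 𝒢.continuous_r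
  have hint : ∀ x, ∫ γ : 𝒢.Fiber x, ∑ i, φ i (p (𝒢.r γ.1)) * f i γ.1 ∂(lam x) =
      ∑ i, φ i (p x) * ∫ γ, f i γ.1 ∂(lam x) := fun x => by
    simp_rw [← integral_const_mul]
    rw [← integral_finsetSum _ fun i _ => (integrable_fiber hG (hfcc i) _).const_mul _]
    refine integral_congr_ae (Eventually.of_forall fun γ => ?_)
    simp only [γ.2]
  refine ⟨fun γ => ∑ i, φ i (p (𝒢.r γ)) * f i γ, ?_, fun γ => ?_, fun x => ?_, fun x hx => ?_,
    fun γ hγ => ?_⟩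
  · convert (ccReal G).sum_mem fun i (_ : i ∈ Finset.univ) =>
      mul_continuous_mem_ccReal ((hφ i).comp hpr) (hfcc i) using 1
    ext γ; simp
  · refine Finset.sum_nonneg fun i _ => ?_
    by_cases hi : φ i (p (𝒢.r γ)) = 0
    · rw [hi, zero_mul]
    · exact mul_nonneg (hφ0 i _) ((hV i _ hi).1 γ rfl)
  · rw [hint]
    refine le_trans (Finset.sum_le_sum fun i _ => ?_) (hφ1 (p x))
    by_cases hi : φ i (p x) = 0
    · rw [hi, zero_mul]
    · exact mul_le_of_le_one_right (hφ0 i _) ((hV i _ hi).2.1 x rfl)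
  · have h1 : 1 - ε = ∑ i, φ i (p x) * (1 - ε) := by
      rw [← Finset.sum_mul, hφQ (p x) ⟨x, Or.inl hx, rfl⟩, one_mul]
    rw [hint, h1]
    refine Finset.sum_le_sum fun i _ => ?_
    by_cases hi : φ i (p x) = 0
    · rw [hi, zero_mul, zero_mul]
    · exact mul_le_mul_of_nonneg_left ((hV i _ hi).2.2.1 x hx rfl) (hφ0 i _)
  · refine (hlam.translationDefect_le_sum hG Finset.univ (fun i => φ i (p (𝒢.r γ))) f
      (fun i _ => hfcc i) (fun i _ => hφ0 i _) _ γ fun γ₁ hγ₁ => ?_).trans ?_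
    · have : p (𝒢.r γ₁) = p (𝒢.r γ) := by
        rcases hγ₁ with h | h
        · rw [h]
        · rw [h, hp.invariant]
      simp only [this]
    · rw [← mul_one ε, ← hφQ (p (𝒢.r γ)) ⟨_, Or.inr ⟨γ, hγ, rfl⟩, rfl⟩, Finset.mul_sum]
      refine Finset.sum_le_sum fun i _ => ?_
      by_cases hi : φ i (p (𝒢.r γ)) = 0
      · rw [hi, zero_mul, mul_zero]
      · rw [mul_comm ε]
        exact mul_le_mul_of_nonneg_left ((hV i _ hi).2.2.2 γ hγ rfl) (hφ0 i _)

theorem hasApproxInvariantDensity_iff_bundleFiber [T2Space T] [LocallyCompactSpace T]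
    (hG : IsLocallyCompactSpace G) [SigmaCompactSpace G] (hlam : 𝒢.IsHaarSystem lam) {p : X → T}
    (hp : 𝒢.IsGroupoidBundle p) :
    𝒢.HasApproxInvariantDensity lam ↔
      ∀ t, (𝒢.bundleFiber hp t).HasApproxInvariantDensity (𝒢.bundleFiberSystem lam hp t) :=
  ⟨fun h _ => h.reduction (isClosed_singleton.preimage hp.continuous),
    fun h => hasApproxInvariantDensity_of_bundleFiber hG hlam hp h⟩

end TopGroupoid

/-! ### Total variation through positive measures -/

section TotalVariation

variable {α β : Type*} [MeasurableSpace α] [MeasurableSpace β]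

/-- `μ - ν` equals `a - b` as a signed measure, and the variation of `a - b` is at most `a + b`,
whether or not `a` and `b` are mutually singular. -/
theorem tvNormSub_le {μ ν : FiniteMeasure α} {a b : Measure α} [IsFiniteMeasure a]
    [IsFiniteMeasure b] (h : (μ : Measure α) + b = ν + a) :
    tvNormSub μ ν ≤ a.real Set.univ + b.real Set.univ := by
  have hs : (μ : Measure α).toSignedMeasure - (ν : Measure α).toSignedMeasure =
      a.toSignedMeasure - b.toSignedMeasure := by
    rw [sub_eq_sub_iff_add_eq_add, ← Measure.toSignedMeasure_add, ← Measure.toSignedMeasure_add,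
      Measure.toSignedMeasure_eq_toSignedMeasure_iff, h, add_comm]
  have hle : ((μ : Measure α).toSignedMeasure - (ν : Measure α).toSignedMeasure).totalVariation
      ≤ a + b := by
    rw [hs, SignedMeasure.totalVariation_eq_variation]
    refine VectorMeasure.variation_le_of_forall_enorm_le fun E hE => ?_
    rw [Measure.toSignedMeasure_sub_apply hE, Measure.add_apply,
      ← ofReal_measureReal (μ := a), ← ofReal_measureReal (μ := b),
      ← ENNReal.ofReal_add measureReal_nonneg measureReal_nonneg, Real.enorm_eq_ofReal_abs]
    refine ENNReal.ofReal_le_ofReal ((abs_sub _ _).trans ?_)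
    rw [abs_of_nonneg measureReal_nonneg, abs_of_nonneg measureReal_nonneg]
  calc tvNormSub μ ν ≤ ((a + b) Set.univ).toReal :=
        ENNReal.toReal_mono (measure_ne_top _ _) (hle _)
    _ = a.real Set.univ + b.real Set.univ := measureReal_add_apply

/-- The Jordan parts attain the bound of `tvNormSub_le`. Estimates can so be run on an additive
identity between positive measures. -/
theorem exists_measure_tvNormSub_eq (μ ν : FiniteMeasure α) :
    ∃ a b : Measure α, IsFiniteMeasure a ∧ IsFiniteMeasure b ∧ (μ : Measure α) + b = ν + a ∧
      tvNormSub μ ν = a.real Set.univ + b.real Set.univ := by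
  set s := (μ : Measure α).toSignedMeasure - (ν : Measure α).toSignedMeasure with hs
  refine ⟨s.toJordanDecomposition.posPart, s.toJordanDecomposition.negPart, inferInstance,
    inferInstance, ?_, ?_⟩
  · have h := s.toSignedMeasure_toJordanDecomposition
    rw [JordanDecomposition.toSignedMeasure, hs, sub_eq_sub_iff_add_eq_add, ← hs,
      ← Measure.toSignedMeasure_add, ← Measure.toSignedMeasure_add,
      Measure.toSignedMeasure_eq_toSignedMeasure_iff] at h
    rw [← h, add_comm]
  · exact measureReal_add_apply

theorem tvNormSub_nonneg (μ ν : FiniteMeasure α) : 0 ≤ tvNormSub μ ν :=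
  ENNReal.toReal_nonneg

theorem tvNormSub_map_le (μ ν : FiniteMeasure α) {f : α → β} (hf : Measurable f) :
    tvNormSub (μ.map f) (ν.map f) ≤ tvNormSub μ ν := by
  obtain ⟨a, b, ha, hb, h, htv⟩ := exists_measure_tvNormSub_eq μ ν
  have h1 : ((μ.map f : FiniteMeasure β) : Measure β) + b.map f = (ν.map f) + a.map f := by
    simp only [FiniteMeasure.toMeasure_map]
    rw [← Measure.map_add _ _ hf, h, Measure.map_add _ _ hf]
  refine (tvNormSub_le h1).trans ?_
  rw [htv, map_measureReal_apply hf MeasurableSet.univ, map_measureReal_apply hf MeasurableSet.univ,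
    Set.preimage_univ]

theorem tvNormSub_withDensity_le {κ : Measure α} {u v : α → ℝ} (hu : Measurable u)
    (hv : Measurable v) (hu0 : 0 ≤ u) (hv0 : 0 ≤ v) (hui : Integrable u κ) (hvi : Integrable v κ)
    {μ ν : FiniteMeasure α}
    (hμ : (μ : Measure α) = κ.withDensity fun x => ENNReal.ofReal (u x))
    (hν : (ν : Measure α) = κ.withDensity fun x => ENNReal.ofReal (v x)) :
    tvNormSub μ ν ≤ ∫ x, |u x - v x| ∂κ := by
  have := isFiniteMeasure_withDensity_ofReal (hui.sub hvi).2
  have := isFiniteMeasure_withDensity_ofReal (hvi.sub hui).2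
  -- `ENNReal.ofReal` truncates at zero, so the added densities are the positive parts of `v - u`
  -- and `u - v`.
  have h : (μ : Measure α) + κ.withDensity (fun x => ENNReal.ofReal ((v - u) x)) =
      ν + κ.withDensity (fun x => ENNReal.ofReal ((u - v) x)) := by
    rw [hμ, hν, ← withDensity_add_left hu.ennreal_ofReal, ← withDensity_add_left hv.ennreal_ofReal]
    congr 1
    ext x
    simp only [Pi.add_apply, Pi.sub_apply]
    rcases le_total (u x) (v x) with hx | hx
    · rw [ENNReal.ofReal_of_nonpos (sub_nonpos.2 hx), add_zero,
        ← ENNReal.ofReal_add (hu0 x) (sub_nonneg.2 hx), add_sub_cancel]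
    · rw [ENNReal.ofReal_of_nonpos (sub_nonpos.2 hx), add_zero,
        ← ENNReal.ofReal_add (hv0 x) (sub_nonneg.2 hx), add_sub_cancel]
  refine (tvNormSub_le h).trans (le_of_eq ?_)
  rw [← measureReal_add_apply, ← withDensity_add_left (hu.sub hv).ennreal_ofReal, measureReal_def,
    withDensity_apply _ MeasurableSet.univ, Measure.restrict_univ,
    integral_eq_lintegral_of_nonneg_ae (f := fun x => |u x - v x|)
      (Eventually.of_forall fun _ => abs_nonneg _) (hui.sub hvi).abs.1]
  congr 1
  refine lintegral_congr fun x => ?_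
  simp only [Pi.add_apply, Pi.sub_apply]
  rcases le_total (u x) (v x) with hx | hx
  · rw [ENNReal.ofReal_of_nonpos (sub_nonpos.2 hx), zero_add, abs_of_nonpos (sub_nonpos.2 hx),
      neg_sub]
  · rw [ENNReal.ofReal_of_nonpos (sub_nonpos.2 hx), add_zero, abs_of_nonneg (sub_nonneg.2 hx)]

end TotalVariation

/-! ### Radon regularity of dominated measures -/

section Regular

variable {α : Type*} [TopologicalSpace α] [T2Space α] [MeasurableSpace α] [BorelSpace α]

/-- Approximation for `ρ` makes differences `U \ A` and `U \ K` small for `ρ`, hence for `ν`. -/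
theorem MeasureTheory.Measure.regular_of_le {ν ρ : Measure α} [ρ.Regular] [IsFiniteMeasure ρ]
    (h : ν ≤ ρ) : ν.Regular := by
  have hν : IsFiniteMeasure ν := isFiniteMeasure_of_le ρ h
  have : ν.OuterRegular := by
    refine ⟨fun A hA r hr => ?_⟩
    obtain ⟨U, hAU, hU, -, hlt⟩ := hA.exists_isOpen_sdiff_lt (measure_ne_top ρ A)
      (ε := r - ν A) (tsub_pos_of_lt hr).ne'
    refine ⟨U, hAU, hU, ?_⟩
    calc ν U = ν A + ν (U \ A) := by
          rw [← measure_inter_add_sdiff U hA, Set.inter_eq_self_of_subset_right hAU]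
      _ < ν A + (r - ν A) :=
          (ENNReal.add_lt_add_iff_left (measure_ne_top ν A)).2 ((h _).trans_lt hlt)
      _ = r := add_tsub_cancel_of_le hr.le
  refine ⟨fun U hU r hr => ?_⟩
  obtain ⟨K, hKU, hK, hlt⟩ := hU.measurableSet.exists_isCompact_sdiff_lt (measure_ne_top ρ U)
    (ε := ν U - r) (tsub_pos_of_lt hr).ne'
  refine ⟨K, hKU, hK, ?_⟩
  have h1 : ν U = ν K + ν (U \ K) := by
    rw [← measure_inter_add_sdiff U hK.measurableSet, Set.inter_eq_self_of_subset_right hKU]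
  by_contra hle
  have h2 : ν U < r + (ν U - r) := by
    calc ν U = ν K + ν (U \ K) := h1
      _ ≤ r + ν (U \ K) := add_le_add_left (not_lt.1 hle) _
      _ < r + (ν U - r) := (ENNReal.add_lt_add_iff_left (ne_top_of_lt hr)).2 ((h _).trans_lt hlt)
  rw [add_tsub_cancel_of_le hr.le] at h2
  exact lt_irrefl _ h2

/-- The measure is dominated by a multiple of `κ` restricted to the compact support of `u`, a finite
regular measure. -/
theorem MeasureTheory.Measure.regular_withDensity_of_hasCompactSupport {κ : Measure α} [κ.Regular]
    {u : α → ℝ} (hu : Continuous u) (hs : HasCompactSupport u) :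
    (κ.withDensity fun x => ENNReal.ofReal (u x)).Regular := by
  obtain ⟨C, hC⟩ := (hs.isCompact_range hu).bddAbove
  have hK : κ (tsupport u) ≠ ⊤ := hs.isCompact.measure_ne_top
  have := Measure.Regular.restrict_of_measure_ne_top hK
  have : (ENNReal.ofReal C • κ.restrict (tsupport u)).Regular :=
    Measure.Regular.smul ENNReal.ofReal_ne_top
  have : IsFiniteMeasure (κ.restrict (tsupport u)) := ⟨by
    rw [Measure.restrict_apply_univ]; exact hK.lt_top⟩
  have : IsFiniteMeasure (ENNReal.ofReal C • κ.restrict (tsupport u)) :=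
    Measure.smul_finite _ ENNReal.ofReal_ne_top
  refine Measure.regular_of_le (ρ := ENNReal.ofReal C • κ.restrict (tsupport u)) ?_
  refine Measure.le_iff.2 fun A hA => ?_
  rw [withDensity_apply _ hA, Measure.smul_apply, Measure.restrict_apply hA, smul_eq_mul]
  calc ∫⁻ x in A, ENNReal.ofReal (u x) ∂κ
      ≤ ∫⁻ x in A, (tsupport u).indicator (fun _ => ENNReal.ofReal C) x ∂κ := by
        refine lintegral_mono fun x => ?_
        by_cases hx : x ∈ tsupport u
        · rw [Set.indicator_of_mem hx]
          exact ENNReal.ofReal_le_ofReal (hC ⟨x, rfl⟩)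
        · rw [image_eq_zero_of_notMem_tsupport hx, ENNReal.ofReal_zero]
          exact zero_le
    _ = ENNReal.ofReal C * κ (A ∩ tsupport u) := by
        rw [lintegral_indicator_const (isClosed_tsupport u).measurableSet,
          Measure.restrict_apply (isClosed_tsupport u).measurableSet, Set.inter_comm]

end Regular

/-! ### Restricting Haar systems and means; means from densities -/

namespace TopGroupoid

variable {G X : Type*} [TopologicalSpace G] [TopologicalSpace X]
  {𝒢 : TopGroupoid G X} {lam : (x : X) → Measure (𝒢.Fiber x)}

theorem map_translate_map_fiberToReduction {A : Set X} (hA : ∀ γ, 𝒢.r γ ∈ A ↔ 𝒢.s γ ∈ A)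
    (γ : 𝒢.RedArrows A) (μ : Measure (𝒢.Fiber (𝒢.s γ.1))) :
    Measure.map ((𝒢.reduction A hA).translate γ)
        (Measure.map (𝒢.fiberToReduction A hA ((𝒢.reduction A hA).s γ)) μ) =
      Measure.map (𝒢.fiberToReduction A hA ((𝒢.reduction A hA).r γ))
        (Measure.map (𝒢.translate γ.1) μ) := by
  have h : Measurable fun γ' : 𝒢.Fiber (𝒢.r γ.1) =>
      𝒢.fiberToReduction A hA ((𝒢.reduction A hA).r γ) γ' :=
    (𝒢.fiberToReduction A hA ((𝒢.reduction A hA).r γ)).measurable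
  exact (Measure.map_map ((𝒢.reduction A hA).measurable_translate γ)
    (𝒢.fiberToReduction A hA _).measurable).trans
      (Measure.map_map h (𝒢.measurable_translate γ.1)).symm

theorem IsHaarSystem.reduction (hG : IsLocallyCompactSpace G) (hlam : 𝒢.IsHaarSystem lam)
    {A : Set X} (hA : ∀ γ, 𝒢.r γ ∈ A ↔ 𝒢.s γ ∈ A) (hAc : IsClosed A) :
    (𝒢.reduction A hA).IsHaarSystem (𝒢.restrictSystem lam A hA) where
  regular x :=
    have := hlam.regular x.1
    Measure.Regular.map _
  fullSupport x :=
    have := hlam.fullSupport x.1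
    (𝒢.fiberToReduction A hA x).continuous.isOpenPosMeasure_map
      (𝒢.fiberToReduction A hA x).surjective
  continuous f hf := by
    have hj := 𝒢.isClosedEmbedding_redArrows hAc
    have := fun x => (hlam.regular x)
    have h1 : ∀ x, (𝒢.restrictSystem lam A hA x).Regular := fun x => Measure.Regular.map _
    refine continuous_integral_ccSpan_of_ccReal (hG.of_isClosedEmbedding hj) (fun f hf => ?_) hf
    obtain ⟨F, hF, hFf⟩ := exists_extension_mem_ccReal hG hj hf
    refine ((hlam.continuous_integral hF).comp continuous_subtype_val).congr fun x => ?_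
    rw [integral_restrictSystem]
    exact integral_congr_ae (Eventually.of_forall fun γ =>
      hFf (𝒢.fiberToReduction A hA x γ).1)
  invariant γ := by
    exact (map_translate_map_fiberToReduction hA γ (lam (𝒢.s γ.1))).trans
      (congrArg (Measure.map fun γ' : 𝒢.Fiber (𝒢.r γ.1) =>
        𝒢.fiberToReduction A hA ((𝒢.reduction A hA).r γ) γ') (hlam.invariant γ.1))

/-- Each test function on the closed reduction extends to `G`, which gives continuity; pushing
forward along the identification of fibres does not increase total variation. -/
theorem HasApproxInvariantMean.reduction (hG : IsLocallyCompactSpace G) {A : Set X}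
    (hA : ∀ γ, 𝒢.r γ ∈ A ↔ 𝒢.s γ ∈ A) (hAc : IsClosed A) (h : 𝒢.HasApproxInvariantMean) :
    (𝒢.reduction A hA).HasApproxInvariantMean := by
  obtain ⟨m, hreg, hmass, hcont, hL, hK⟩ := h
  have hj := 𝒢.isClosedEmbedding_redArrows hAc
  have hm : ∀ n (x : A), (((m n x.1).map (𝒢.fiberToReduction A hA x)).mass : ℝ) =
      (m n x.1).mass := fun n x => by
    rw [FiniteMeasure.mass, FiniteMeasure.map_apply _ (𝒢.fiberToReduction A hA x).measurable
      MeasurableSet.univ]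
    rfl
  refine ⟨fun n x => (m n x.1).map (𝒢.fiberToReduction A hA x), fun n x => ?_, fun n x => ?_,
    fun n f hf => ?_, fun L hLc => ?_, fun K hKc => ?_⟩
  · have := hreg n x.1
    exact Measure.Regular.map _
  · rw [← NNReal.coe_le_coe, hm]
    exact hmass n x.1
  · refine continuous_integral_ccSpan_of_ccReal (hG.of_isClosedEmbedding hj) (fun f hf => ?_) hf
    obtain ⟨F, hF, hFf⟩ := exists_extension_mem_ccReal hG hj hf
    refine ((continuous_integral_ccReal_of_ccSpan (hcont n) hF).comp
      continuous_subtype_val).congr fun x => ?_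
    rw [FiniteMeasure.toMeasure_map,
      (𝒢.fiberToReduction A hA x).measurableEmbedding.integral_map]
    exact integral_congr_ae (Eventually.of_forall fun γ =>
      hFf (𝒢.fiberToReduction A hA x γ).1)
  · refine (((hL _ (hLc.image continuous_subtype_val)).comp Subtype.val).mono
      (Set.subset_preimage_image _ _)).congr (Eventually.of_forall fun n x _ => ?_)
    exact (hm n x).symm
  · have h1 := Metric.tendstoUniformlyOn_iff.1 (hK _ (hKc.image continuous_subtype_val))
    refine Metric.tendstoUniformlyOn_iff.2 fun ε hε => ?_
    filter_upwards [h1 ε hε] with n hn γ hγ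
    refine lt_of_le_of_lt ?_ (hn γ.1 ⟨γ, hγ, rfl⟩)
    rw [dist_comm, dist_zero_right, dist_comm, dist_zero_right, Real.norm_of_nonneg
      (tvNormSub_nonneg _ _), Real.norm_of_nonneg (tvNormSub_nonneg _ _)]
    refine le_trans (le_of_eq ?_) (tvNormSub_map_le _ _
      (𝒢.fiberToReduction A hA ((𝒢.reduction A hA).r γ)).measurable)
    congr 1
    exact Subtype.ext (map_translate_map_fiberToReduction hA γ (m n (𝒢.s γ.1)))

theorem IsHaarSystem.map_translate_withDensity (hlam : 𝒢.IsHaarSystem lam) (γ : G)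
    {u : 𝒢.Fiber (𝒢.r γ) → ENNReal} (hu : Measurable u) :
    ((lam (𝒢.s γ)).withDensity (u ∘ 𝒢.translate γ)).map (𝒢.translate γ) =
      (lam (𝒢.r γ)).withDensity u := by
  ext A hA
  rw [Measure.map_apply (𝒢.measurable_translate γ) hA, withDensity_apply _ hA,
    withDensity_apply _ (𝒢.measurable_translate γ hA), ← hlam.invariant γ,
    setLIntegral_map hA hu (𝒢.measurable_translate γ)]
  rfl

/-- The mean is `g n · λ^x`. By invariance its translate has density `g n (γ⁻¹ ·)`, so the variation
norm is at most the translation defect. As `G` is Hausdorff, `g n` is continuous and `g n · f` stays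
in `𝒞_c`. -/
theorem HasApproxInvariantDensity.hasApproxInvariantMean [T2Space G]
    (hG : IsLocallyCompactSpace G) (hlam : 𝒢.IsHaarSystem lam)
    (h : 𝒢.HasApproxInvariantDensity lam) : 𝒢.HasApproxInvariantMean := by
  obtain ⟨g, hg, hg0, hg1, hgL, hgK⟩ := h
  have := hlam.isFiniteMeasureOnCompacts
  have hg := fun n => ofReal_mem_ccSpan_iff.1 (hg n)
  have hc := fun n x => (fiber_continuous (𝒢 := 𝒢) hG (hg n) x).1
  have hi := fun n x => integrable_fiber hG (hg n) (lam x)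
  let m : ℕ → (x : X) → FiniteMeasure (𝒢.Fiber x) := fun n x =>
    ⟨(lam x).withDensity fun γ => ENNReal.ofReal (g n γ.1),
      isFiniteMeasure_withDensity_ofReal (hi n x).2⟩
  have hm : ∀ n x, (m n x : Measure (𝒢.Fiber x)) =
    (lam x).withDensity fun γ => ENNReal.ofReal (g n γ.1) := fun n x => rfl
  have hmass : ∀ n x, ((m n x).mass : ℝ) = ∫ γ, g n γ.1 ∂(lam x) := fun n x => by
    have h1 : ((m n x).mass : ℝ) = ((m n x : Measure (𝒢.Fiber x)) Set.univ).toReal := rfl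
    rw [h1, hm, withDensity_apply _ MeasurableSet.univ, Measure.restrict_univ]
    exact (integral_eq_lintegral_of_nonneg_ae (Eventually.of_forall fun γ => hg0 n _)
      (hi n x).1).symm
  refine ⟨m, fun n x => ?_, fun n x => ?_, fun n f hf => ?_, fun L hL => ?_, fun K hK => ?_⟩
  · have := hlam.regular x
    have := 𝒢.fiber_t2Space hG x
    exact Measure.regular_withDensity_of_hasCompactSupport (hc n x)
      (fiber_continuous (𝒢 := 𝒢) hG (hg n) x).2
  · rw [← NNReal.coe_le_coe, hmass]
    exact hg1 n x
  · refine continuous_integral_ccSpan_of_ccReal hG (fun f hf => ?_) hf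
    refine (hlam.continuous_integral (mul_continuous_mem_ccReal
      (mem_ccReal_iff_of_t2.1 (hg n)).1 hf)).congr fun x => ?_
    rw [hm, integral_withDensity_eq_integral_toReal_smul (hc n x).measurable.ennreal_ofReal
      (Eventually.of_forall fun _ => ENNReal.ofReal_lt_top)]
    refine integral_congr_ae (Eventually.of_forall fun γ => ?_)
    simp only [ENNReal.toReal_ofReal (hg0 n _), smul_eq_mul]
  · exact (hgL L hL).congr (Eventually.of_forall fun n x _ => (hmass n x).symm)
  · have h1 := Metric.tendstoUniformlyOn_iff.1 (hgK K hK)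
    refine Metric.tendstoUniformlyOn_iff.2 fun ε hε => ?_
    filter_upwards [h1 ε hε] with n hn γ hγ
    refine lt_of_le_of_lt ?_ (hn γ hγ)
    rw [dist_comm, dist_zero_right, dist_comm, dist_zero_right, Real.norm_of_nonneg
      (tvNormSub_nonneg _ _), Real.norm_of_nonneg (integral_nonneg fun _ => abs_nonneg _)]
    have hu : Continuous fun γ₁ : 𝒢.Fiber (𝒢.r γ) =>
        g n (𝒢.mul (𝒢.inv γ) γ₁.1 ((𝒢.s_inv γ).trans γ₁.2.symm)) :=
      (hc n (𝒢.s γ)).comp (𝒢.translateHomeomorph γ).symm.continuous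
    refine tvNormSub_withDensity_le hu.measurable (hc n _).measurable (fun _ => hg0 n _)
      (fun _ => hg0 n _) (integrable_inv_mul hG (hg n) γ _) (hi n _) ?_ rfl
    rw [← hlam.map_translate_withDensity γ hu.measurable.ennreal_ofReal,
      FiniteMeasure.toMeasure_map,
      hm]
    congr 2
    ext γ₁
    simp only [Function.comp_apply]
    exact congrArg (fun δ => ENNReal.ofReal (g n δ)) (𝒢.inv_mul_cancel_left γ γ₁.1 _ _).symm

end TopGroupoid

/-! ### Kernel operators on a single fibre -/

section Kernel

variable {α : Type*} [TopologicalSpace α] [MeasurableSpace α] [BorelSpace α]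

/-- A kernel on `α` whose products with compactly supported functions of the first variable are
continuous and compactly supported. -/
def IsProperKernel (k : α → α → ℝ) : Prop :=
  ∀ ψ : α → ℝ, Continuous ψ → HasCompactSupport ψ →
    Continuous (fun q : α × α => k q.1 q.2 * ψ q.1) ∧
      HasCompactSupport (fun q : α × α => k q.1 q.2 * ψ q.1)

variable {k : α → α → ℝ} {ψ : α → ℝ}

theorem IsProperKernel.integrable_left (hk : IsProperKernel k) (hψ : Continuous ψ)
    (hs : HasCompactSupport ψ) (σ : Measure α) [IsFiniteMeasureOnCompacts σ] (y : α) :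
    Integrable (fun x => k x y * ψ x) σ := by
  refine Continuous.integrable_of_hasCompactSupport ?_ (HasCompactSupport.mul_left hs)
  exact (hk ψ hψ hs).1.comp (continuous_id.prodMk continuous_const)

theorem IsProperKernel.integrable_integral [T2Space α] (hk : IsProperKernel k) (hψ : Continuous ψ)
    (hs : HasCompactSupport ψ) (σ : Measure α) [IsFiniteMeasureOnCompacts σ] (lam : Measure α)
    [IsFiniteMeasureOnCompacts lam] : Integrable (fun y => ∫ x, k x y * ψ x ∂σ) lam := by
  obtain ⟨h1, h2⟩ := hk ψ hψ hs
  refine Continuous.integrable_of_hasCompactSupport ?_ ?_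
  · rw [← continuousOn_univ]
    refine continuousOn_integral_of_compact_support hs.isCompact ?_ fun y x _ hx => ?_
    · exact (h1.comp continuous_swap).continuousOn
    · rw [image_eq_zero_of_notMem_tsupport hx, mul_zero]
  · refine HasCompactSupport.intro (h2.isCompact.image continuous_snd) fun y hy => ?_
    refine integral_eq_zero_of_ae (Eventually.of_forall fun x => ?_)
    exact image_eq_zero_of_notMem_tsupport (f := fun q : α × α => k q.1 q.2 * ψ q.1) (x := (x, y))
      fun h => hy ⟨_, h, rfl⟩

theorem IsProperKernel.integral_integral (hk : IsProperKernel k) (hψ : Continuous ψ)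
    (hs : HasCompactSupport ψ) (σ : Measure α) [IsFiniteMeasureOnCompacts σ] (lam : Measure α)
    [IsFiniteMeasureOnCompacts lam] :
    ∫ y, ∫ x, k x y * ψ x ∂σ ∂lam = ∫ x, (∫ y, k x y ∂lam) * ψ x ∂σ := by
  obtain ⟨h1, h2⟩ := hk ψ hψ hs
  rw [← integral_integral_swap_of_hasCompactSupport (f := fun x y => k x y * ψ x) h1 h2]
  simp only [integral_mul_const]

theorem IsProperKernel.integral_integral_le (hk : IsProperKernel k) (hk0 : ∀ x y, 0 ≤ k x y)
    {lam : Measure α} [IsFiniteMeasureOnCompacts lam] (hk1 : ∀ x, ∫ y, k x y ∂lam ≤ 1)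
    (hψ : Continuous ψ) (hs : HasCompactSupport ψ) (hψ0 : ∀ x, 0 ≤ ψ x) (σ : Measure α)
    [IsFiniteMeasureOnCompacts σ] :
    ∫ y, ∫ x, k x y * ψ x ∂σ ∂lam ≤ ∫ x, ψ x ∂σ := by
  rw [hk.integral_integral hψ hs]
  refine integral_mono_of_nonneg
    (Eventually.of_forall fun x => mul_nonneg (integral_nonneg fun y => hk0 x y) (hψ0 x))
    (hψ.integrable_of_hasCompactSupport hs)
    (Eventually.of_forall fun x => mul_le_of_le_one_left (hψ0 x) (hk1 x))

theorem integral_le_measureReal_univ (hψ : Continuous ψ) (hs : HasCompactSupport ψ)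
    (hψ1 : ∀ x, ψ x ≤ 1) (σ : Measure α) [IsFiniteMeasure σ] :
    ∫ x, ψ x ∂σ ≤ σ.real Set.univ := by
  calc ∫ x, ψ x ∂σ ≤ ∫ _, (1 : ℝ) ∂σ :=
        integral_mono (hψ.integrable_of_hasCompactSupport hs) (integrable_const _) hψ1
    _ = σ.real Set.univ := by simp

/-- The kernel contracts masses, so replacing `m₁` by `m₂` under `ψ₁` costs the masses of `a` and
`b`, and replacing `ψ₁` by `ψ₂` costs the integrals of `1 - ψ₁` and `1 - ψ₂` against `m₂`. Each
cut-off is to be measured against its own measure: moving `1 - ψ₁` from `m₂` to `m₁` costs the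
second mass of `b`. -/
theorem IsProperKernel.integral_abs_sub_le [T2Space α] (hk : IsProperKernel k)
    (hk0 : ∀ x y, 0 ≤ k x y) {lam : Measure α} [IsFiniteMeasureOnCompacts lam]
    (hk1 : ∀ x, ∫ y, k x y ∂lam ≤ 1) {ψ₁ ψ₂ : α → ℝ} (hψ₁ : Continuous ψ₁) (hs₁ : HasCompactSupport ψ₁) (h₁0 : ∀ x, 0 ≤ ψ₁ x)
    (h₁1 : ∀ x, ψ₁ x ≤ 1) (hψ₂ : Continuous ψ₂) (hs₂ : HasCompactSupport ψ₂)
    (h₂1 : ∀ x, ψ₂ x ≤ 1) {m₁ m₂ a b : Measure α} [IsFiniteMeasure m₁]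
    [IsFiniteMeasure m₂] [IsFiniteMeasure a] [IsFiniteMeasure b] (h : m₁ + b = m₂ + a) :
    ∫ y, |(∫ x, k x y * ψ₁ x ∂m₁) - ∫ x, k x y * ψ₂ x ∂m₂| ∂lam ≤
      a.real Set.univ + 2 * b.real Set.univ + (∫ x, (1 - ψ₁ x) ∂m₁) + ∫ x, (1 - ψ₂ x) ∂m₂ := by
  have hc : Continuous fun x => |ψ₁ x - ψ₂ x| := (hψ₁.sub hψ₂).abs
  have hcs : HasCompactSupport fun x => |ψ₁ x - ψ₂ x| :=
    (hs₁.sub hs₂).comp_left (g := fun t : ℝ => |t|) abs_zero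
  have I₁ : ∀ (σ : Measure α) [IsFiniteMeasure σ], Integrable ψ₁ σ := fun σ _ =>
    hψ₁.integrable_of_hasCompactSupport hs₁
  have I₂ : ∀ (σ : Measure α) [IsFiniteMeasure σ], Integrable ψ₂ σ := fun σ _ =>
    hψ₂.integrable_of_hasCompactSupport hs₂
  have key : ∀ y, |(∫ x, k x y * ψ₁ x ∂m₁) - ∫ x, k x y * ψ₂ x ∂m₂| ≤
      ((∫ x, k x y * ψ₁ x ∂a) + ∫ x, k x y * ψ₁ x ∂b) + ∫ x, k x y * |ψ₁ x - ψ₂ x| ∂m₂ := by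
    intro y
    have e1 : (∫ x, k x y * ψ₁ x ∂m₁) + ∫ x, k x y * ψ₁ x ∂b =
        (∫ x, k x y * ψ₁ x ∂m₂) + ∫ x, k x y * ψ₁ x ∂a := by
      rw [← integral_add_measure (hk.integrable_left hψ₁ hs₁ _ y)
        (hk.integrable_left hψ₁ hs₁ _ y), h, integral_add_measure
        (hk.integrable_left hψ₁ hs₁ _ y) (hk.integrable_left hψ₁ hs₁ _ y)]
    have e2 : |(∫ x, k x y * ψ₁ x ∂m₂) - ∫ x, k x y * ψ₂ x ∂m₂| ≤
        ∫ x, k x y * |ψ₁ x - ψ₂ x| ∂m₂ := by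
      rw [← integral_sub (hk.integrable_left hψ₁ hs₁ _ y) (hk.integrable_left hψ₂ hs₂ _ y)]
      refine abs_integral_le_integral_abs.trans (le_of_eq ?_)
      congr 1
      ext x
      rw [← mul_sub, abs_mul, abs_of_nonneg (hk0 x y)]
    have e3 : 0 ≤ ∫ x, k x y * ψ₁ x ∂a := integral_nonneg fun x => mul_nonneg (hk0 x y) (h₁0 x)
    have e4 : 0 ≤ ∫ x, k x y * ψ₁ x ∂b := integral_nonneg fun x => mul_nonneg (hk0 x y) (h₁0 x)
    rw [abs_le] at e2 ⊢
    constructor <;> linarith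
  have J₁ := hk.integrable_integral hψ₁ hs₁ a lam
  have J₂ := hk.integrable_integral hψ₁ hs₁ b lam
  have J₃ := hk.integrable_integral hc hcs m₂ lam
  have s1 : ∫ y, |(∫ x, k x y * ψ₁ x ∂m₁) - ∫ x, k x y * ψ₂ x ∂m₂| ∂lam ≤
      ((∫ y, ∫ x, k x y * ψ₁ x ∂a ∂lam) + ∫ y, ∫ x, k x y * ψ₁ x ∂b ∂lam) +
        ∫ y, ∫ x, k x y * |ψ₁ x - ψ₂ x| ∂m₂ ∂lam := by
    rw [← integral_add J₁ J₂, ← integral_add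
      (f := fun y => (∫ x, k x y * ψ₁ x ∂a) + ∫ x, k x y * ψ₁ x ∂b) (J₁.add J₂) J₃]
    exact integral_mono_of_nonneg (Eventually.of_forall fun _ => abs_nonneg _)
      ((J₁.add J₂).add J₃) (Eventually.of_forall key)
  have s2 := (hk.integral_integral_le hk0 hk1 hψ₁ hs₁ h₁0 a).trans
    (integral_le_measureReal_univ hψ₁ hs₁ h₁1 a)
  have s3 := (hk.integral_integral_le hk0 hk1 hψ₁ hs₁ h₁0 b).trans
    (integral_le_measureReal_univ hψ₁ hs₁ h₁1 b)
  have s4 := hk.integral_integral_le hk0 hk1 hc hcs (fun x => abs_nonneg _) m₂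
  have K₁ : ∀ (σ : Measure α) [IsFiniteMeasure σ], Integrable (fun x => 1 - ψ₁ x) σ :=
    fun σ _ => (integrable_const _).sub (I₁ σ)
  have K₂ : ∀ (σ : Measure α) [IsFiniteMeasure σ], Integrable (fun x => 1 - ψ₂ x) σ :=
    fun σ _ => (integrable_const _).sub (I₂ σ)
  have s5 : ∫ x, |ψ₁ x - ψ₂ x| ∂m₂ ≤ (∫ x, (1 - ψ₁ x) ∂m₂) + ∫ x, (1 - ψ₂ x) ∂m₂ := by
    rw [← integral_add (K₁ m₂) (K₂ m₂)]
    refine integral_mono (hc.integrable_of_hasCompactSupport hcs) ((K₁ m₂).add (K₂ m₂)) fun x => ?_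
    have := h₁1 x
    have := h₂1 x
    rw [abs_le]
    constructor <;> linarith
  have s6 : (∫ x, (1 - ψ₁ x) ∂m₁) + ∫ x, (1 - ψ₁ x) ∂b =
      (∫ x, (1 - ψ₁ x) ∂m₂) + ∫ x, (1 - ψ₁ x) ∂a := by
    rw [← integral_add_measure (K₁ _) (K₁ _), h, integral_add_measure (K₁ _) (K₁ _)]
  have s7 : 0 ≤ ∫ x, (1 - ψ₁ x) ∂a := integral_nonneg fun x => sub_nonneg.2 (h₁1 x)
  have s8 : ∫ x, (1 - ψ₁ x) ∂b ≤ b.real Set.univ := by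
    calc ∫ x, (1 - ψ₁ x) ∂b ≤ ∫ _, (1 : ℝ) ∂b :=
          integral_mono (K₁ b) (integrable_const _) fun x => by
            simpa using h₁0 x
      _ = b.real Set.univ := by simp
  linarith

end Kernel

/-! ### Kernel, cut-off and normalized function for the convolution -/

namespace TopGroupoid

variable {G X : Type*} [TopologicalSpace G] [TopologicalSpace X]
  {𝒢 : TopGroupoid G X} {lam : (x : X) → Measure (𝒢.Fiber x)}

theorem inv_mul_mul (𝒢 : TopGroupoid G X) (a b c : G) (h : 𝒢.s a = 𝒢.r b)
    (h₁ : 𝒢.s (𝒢.inv (𝒢.mul a b h)) = 𝒢.r c) (h₂ : 𝒢.s (𝒢.inv a) = 𝒢.r c)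
    (h₃ : 𝒢.s (𝒢.inv b) = 𝒢.r (𝒢.mul (𝒢.inv a) c h₂)) :
    𝒢.mul (𝒢.inv (𝒢.mul a b h)) c h₁ = 𝒢.mul (𝒢.inv b) (𝒢.mul (𝒢.inv a) c h₂) h₃ := by
  have hs : 𝒢.s b = 𝒢.r (𝒢.mul (𝒢.inv b) (𝒢.mul (𝒢.inv a) c h₂) h₃) :=
    ((𝒢.r_mul _ _ _).trans (𝒢.r_inv b)).symm
  have key : 𝒢.mul (𝒢.mul a b h) (𝒢.mul (𝒢.inv b) (𝒢.mul (𝒢.inv a) c h₂) h₃)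
      ((𝒢.s_mul _ _ _).trans hs) = c := by
    rw [𝒢.mul_assoc a b _ h hs]
    have h4 := 𝒢.mul_inv_cancel_left b (𝒢.mul (𝒢.inv a) c h₂) h₃ hs
    simp only [h4]
    exact 𝒢.mul_inv_cancel_left a c h₂ _
  have h5 := 𝒢.inv_mul_cancel_left (𝒢.mul a b h)
    (𝒢.mul (𝒢.inv b) (𝒢.mul (𝒢.inv a) c h₂) h₃) ((𝒢.s_mul _ _ _).trans hs)
    ((𝒢.s_inv _).trans (𝒢.r_mul _ _ _).symm)
  simp only [key] at h5
  exact h5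

/-- The homeomorphism exchanging the two factors of `G ×_X G`. -/
def pullbackSwap (𝒢 : TopGroupoid G X) :
    𝒢.Pullback (fun γ => 𝒢.r γ) ≃ₜ 𝒢.Pullback (fun γ => 𝒢.r γ) where
  toFun q := ⟨(q.1.2, q.1.1), q.2.symm⟩
  invFun q := ⟨(q.1.2, q.1.1), q.2.symm⟩
  left_inv _ := rfl
  right_inv _ := rfl
  continuous_toFun := (continuous_swap.comp continuous_subtype_val).subtype_mk _
  continuous_invFun := (continuous_swap.comp continuous_subtype_val).subtype_mk _

theorem inv_mul_mem_ccReal_pullback [T2Space G] (𝒢 : TopGroupoid G X) {f φ : G → ℝ}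
    (hf : f ∈ ccReal G) (hφ : φ ∈ ccReal G) :
    (fun q : 𝒢.Pullback (fun γ => 𝒢.r γ) =>
      f (𝒢.mul (𝒢.inv q.1.2) q.1.1 ((𝒢.s_inv _).trans q.2.symm)) * φ q.1.2) ∈ ccReal _ := by
  obtain ⟨h1, h2⟩ := mem_ccReal_iff_of_t2.1 hφ
  have h := comp_mem_ccReal ((𝒢.pullbackSwap).trans
    (𝒢.pullbackInvMul (continuous_id (X := G)))).isClosedEmbedding
    (𝒢.mul_mem_ccReal_pullback 𝒢.continuous_s h1 h2 hf)
  convert h using 1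
  ext q
  exact mul_comm _ _

/-- If `γ₁` and `γ₁⁻¹ γ` range over compact sets, so does `γ`. After extending `ψ` to `G`, the
kernel is a restriction from `G ×_X G`, in which the square of the fibre is closed. -/
theorem isProperKernel_inv_mul [T2Space G] (hG : IsLocallyCompactSpace G) {f : G → ℝ}
    (hf : f ∈ ccReal G) (x : X) :
    IsProperKernel fun γ₁ γ : 𝒢.Fiber x =>
      f (𝒢.mul (𝒢.inv γ₁.1) γ.1 ((𝒢.s_inv _).trans (γ₁.2.trans γ.2.symm))) := by
  intro ψ hψ hψs
  have := 𝒢.fiber_t2Space hG x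
  have := 𝒢.t2Space_units
  obtain ⟨φ, hφ, hφψ⟩ := exists_extension_mem_ccReal hG (𝒢.isClosedEmbedding_fiber x)
    (mem_ccReal_iff_of_t2.2 ⟨hψ, hψs⟩)
  have hj : IsClosedEmbedding fun q : 𝒢.Fiber x × 𝒢.Fiber x =>
      (⟨(q.2.1, q.1.1), q.2.2.trans q.1.2.symm⟩ : 𝒢.Pullback (fun γ => 𝒢.r γ)) := by
    have h1 := (𝒢.isClosedEmbedding_fiber x).isEmbedding.prodMap
      (𝒢.isClosedEmbedding_fiber x).isEmbedding
    have hc : Continuous fun q : 𝒢.Fiber x × 𝒢.Fiber x =>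
        (⟨(q.2.1, q.1.1), q.2.2.trans q.1.2.symm⟩ : 𝒢.Pullback (fun γ => 𝒢.r γ)) :=
      ((continuous_subtype_val.comp continuous_snd).prodMk
        (continuous_subtype_val.comp continuous_fst)).subtype_mk _
    refine ⟨IsEmbedding.of_comp (g := fun q : 𝒢.Pullback (fun γ => 𝒢.r γ) => (q.1.2, q.1.1)) hc
      (continuous_swap.comp continuous_subtype_val) h1, ?_⟩
    convert (isClosed_singleton (x := x)).preimage ((𝒢.continuous_r.comp continuous_fst).comp
      continuous_subtype_val : Continuous fun q : 𝒢.Pullback (fun γ => 𝒢.r γ) => 𝒢.r q.1.1) using 1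
    ext ⟨⟨γ, γ₁⟩, hq⟩
    constructor
    · rintro ⟨⟨a, b⟩, h⟩
      have h2 : b.1 = γ := congrArg (fun q : 𝒢.Pullback (fun γ => 𝒢.r γ) => q.1.1) h
      exact (congrArg 𝒢.r h2).symm.trans b.2
    · intro h
      exact ⟨(⟨γ₁, hq.symm.trans h⟩, ⟨γ, h⟩), rfl⟩
  have h := mem_ccReal_iff_of_t2.1 (comp_mem_ccReal hj (𝒢.inv_mul_mem_ccReal_pullback hf hφ))
  simp only [hφψ] at h
  exact h

/-- At one point, compact subsets exhaust the mass by σ-compactness; continuity of the integral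
spreads the bound to a neighbourhood. Finitely many cut-offs are combined by a maximum, which stays
in `𝒞_c` since `G` is Hausdorff. -/
theorem exists_cutoff_of_mass [T2Space G] (hG : IsLocallyCompactSpace G) [SigmaCompactSpace G]
    {μ : (x : X) → FiniteMeasure (𝒢.Fiber x)}
    (hμ : ∀ f ∈ ccSpan G, Continuous fun x => ∫ γ, f γ.1 ∂(μ x : Measure (𝒢.Fiber x)))
    {L : Set X} (hL : IsCompact L) {c : ℝ} (hc : ∀ x ∈ L, c < (μ x).mass) :
    ∃ φ ∈ ccReal G, (∀ γ, 0 ≤ φ γ) ∧ (∀ γ, φ γ ≤ 1) ∧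
      ∀ x ∈ L, c < ∫ γ, φ γ.1 ∂(μ x : Measure (𝒢.Fiber x)) := by
  have hlc := hG.locallyCompactSpace
  suffices h : ∃ φ ∈ ccReal G, (∀ γ, 0 ≤ φ γ) ∧ (∀ γ, φ γ ≤ 1) ∧
      ∀ x ∈ L, x ∈ L → c < ∫ γ, φ γ.1 ∂(μ x : Measure (𝒢.Fiber x)) by
    obtain ⟨φ, h1, h2, h3, h4⟩ := h
    exact ⟨φ, h1, h2, h3, fun x hx => h4 x hx hx⟩
  refine hL.induction_on (p := fun S => ∃ φ ∈ ccReal G, (∀ γ, 0 ≤ φ γ) ∧ (∀ γ, φ γ ≤ 1) ∧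
      ∀ x ∈ S, x ∈ L → c < ∫ γ, φ γ.1 ∂(μ x : Measure (𝒢.Fiber x))) ?_ ?_ ?_ ?_
  · exact ⟨0, (ccReal G).zero_mem, fun _ => le_rfl, fun _ => zero_le_one, by simp⟩
  · rintro S S' hS ⟨φ, h1, h2, h3, h4⟩
    exact ⟨φ, h1, h2, h3, fun x hx => h4 x (hS hx)⟩
  · rintro S S' ⟨φ, h1, h2, h3, h4⟩ ⟨φ', h1', h2', h3', h4'⟩
    have hm : (fun γ => max (φ γ) (φ' γ)) ∈ ccReal G := by
      rw [mem_ccReal_iff_of_t2] at h1 h1' ⊢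
      exact ⟨h1.1.max h1'.1, h1.2.sup h1'.2⟩
    refine ⟨fun γ => max (φ γ) (φ' γ), hm, fun γ => (h2 γ).trans (le_max_left _ _),
      fun γ => max_le (h3 γ) (h3' γ), ?_⟩
    rintro x (hx | hx) hxL
    · exact (h4 x hx hxL).trans_le (integral_mono (integrable_fiber hG h1 _)
        (integrable_fiber hG hm _) fun γ => le_max_left _ _)
    · exact (h4' x hx hxL).trans_le (integral_mono (integrable_fiber hG h1' _)
        (integrable_fiber hG hm _) fun γ => le_max_right _ _)
  · intro x hx
    let E : CompactExhaustion G := default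
    let A : ℕ → Set (𝒢.Fiber x) := fun n => {γ | γ.1 ∈ E n}
    have hclosed : ∀ n, IsClosed (A n) := fun n =>
      (E.isCompact n).isClosed.preimage continuous_subtype_val
    have hmeas : ∀ n, MeasurableSet (A n) := fun n => (hclosed n).measurableSet
    have hmono : Monotone A := fun a b hab γ hγ => E.subset hab hγ
    have hlim := tendsto_measure_iUnion_atTop (μ := (μ x : Measure (𝒢.Fiber x))) hmono
    have hun : ⋃ n, A n = Set.univ :=
      Set.eq_univ_of_forall fun γ => Set.mem_iUnion.2 (E.exists_mem γ.1)
    rw [hun] at hlim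
    have hlim' := (ENNReal.tendsto_toReal (measure_ne_top _ _)).comp hlim
    obtain ⟨n, hn⟩ := (hlim'.eventually (lt_mem_nhds (hc x hx))).exists
    obtain ⟨φ, hφ1, -, hφs, hφ⟩ := exists_continuous_one_zero_of_isCompact (E.isCompact n)
      isClosed_empty (Set.disjoint_empty _)
    have hφc : (φ : G → ℝ) ∈ ccReal G := mem_ccReal_iff_of_t2.2 ⟨φ.continuous, hφs⟩
    have hlt : c < ∫ γ, φ γ.1 ∂(μ x : Measure (𝒢.Fiber x)) := by
      refine hn.trans_le ?_
      have := integral_indicator_one (μ := (μ x : Measure (𝒢.Fiber x))) (hmeas n)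
      refine (le_of_eq this.symm).trans (integral_mono
        ((integrable_const (1 : ℝ)).indicator (hmeas n)) (integrable_fiber hG hφc _) fun γ => ?_)
      by_cases hγ : γ ∈ A n
      · rw [Set.indicator_of_mem hγ, hφ1 hγ]
        exact le_rfl
      · rw [Set.indicator_of_notMem hγ]
        exact (hφ _).1
    refine ⟨{y | c < ∫ γ, φ γ.1 ∂(μ y : Measure (𝒢.Fiber y))}, mem_nhdsWithin_of_mem_nhds
      (((continuous_integral_ccReal_of_ccSpan hμ hφc).tendsto x).eventually (lt_mem_nhds hlt)),
      φ, hφc, fun γ => (hφ γ).1, fun γ => (hφ γ).2, fun y hy _ => hy⟩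

/-- Full support makes the integrals of `k` positive on `S`, hence at least some `δ > 0`. Dividing
by their maximum with `δ` keeps the divisor continuous and nonzero off `S`. -/
theorem IsHaarSystem.exists_normalized (hG : IsLocallyCompactSpace G)
    (hlam : 𝒢.IsHaarSystem lam) {S : Set X} (hS : IsCompact S) :
    ∃ f ∈ ccReal G, (∀ γ, 0 ≤ f γ) ∧ (∀ x, ∫ γ, f γ.1 ∂(lam x) ≤ 1) ∧
      ∀ x ∈ S, ∫ γ, f γ.1 ∂(lam x) = 1 := by
  have := hlam.isFiniteMeasureOnCompacts
  obtain ⟨k, hk, hk0, hk1⟩ :=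
    exists_mem_ccReal_one_le hG (hS.image 𝒢.isEmbedding_unit.continuous)
  have hc := hlam.continuous_integral hk
  have hpos : ∀ x ∈ S, 0 < ∫ γ, k γ.1 ∂(lam x) := fun x hx => by
    have := hlam.fullSupport x
    obtain ⟨h1, h2⟩ := fiber_continuous (𝒢 := 𝒢) hG hk x
    refine h1.integral_pos_of_hasCompactSupport_nonneg_nonzero h2 (fun γ => hk0 _)
      (x := ⟨𝒢.unit x, 𝒢.r_unit x⟩) ?_
    exact (zero_lt_one.trans_le (hk1 _ ⟨x, hx, rfl⟩)).ne'
  obtain ⟨δ, hδ, hδS⟩ : ∃ δ > 0, ∀ x ∈ S, δ ≤ ∫ γ, k γ.1 ∂(lam x) :=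
    hS.exists_forall_le' hc.continuousOn hpos
  have hD : ∀ x, 0 < max (∫ γ, k γ.1 ∂(lam x)) δ := fun x => hδ.trans_le (le_max_right _ _)
  have hint : ∀ x, ∫ γ : 𝒢.Fiber x, (max (∫ γ, k γ.1 ∂(lam (𝒢.r γ.1))) δ)⁻¹ * k γ.1 ∂(lam x) =
      (max (∫ γ, k γ.1 ∂(lam x)) δ)⁻¹ * ∫ γ, k γ.1 ∂(lam x) := fun x => by
    rw [← integral_const_mul]
    refine integral_congr_ae (Eventually.of_forall fun γ => ?_)
    exact congrArg (fun y => (max (∫ γ, k γ.1 ∂(lam y)) δ)⁻¹ * k γ.1) γ.2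
  refine ⟨fun γ => (max (∫ γ, k γ.1 ∂(lam (𝒢.r γ))) δ)⁻¹ * k γ, mul_continuous_mem_ccReal
    (((hc.comp 𝒢.continuous_r).max continuous_const).inv₀ fun γ => (hD _).ne') hk,
    fun γ => mul_nonneg (inv_nonneg.2 (hD _).le) (hk0 γ), fun x => ?_, fun x hx => ?_⟩
  · rw [hint, inv_mul_le_iff₀ (hD x), mul_one]
    exact le_max_left _ _
  · rw [hint, max_eq_left (hδS x hx)]
    exact inv_mul_cancel₀ (hpos x hx).ne'

end TopGroupoid

/-! ### Densities from means by convolution -/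

namespace TopGroupoid

variable {G X T : Type*} [TopologicalSpace G] [TopologicalSpace X] [TopologicalSpace T]
  {𝒢 : TopGroupoid G X} {lam : (x : X) → Measure (𝒢.Fiber x)}

/-- The convolution `γ ↦ ∫ f(γ₁⁻¹ γ) φ(γ₁) dm^{r(γ)}(γ₁)`. -/
noncomputable def meanConv (𝒢 : TopGroupoid G X) (m : (x : X) → FiniteMeasure (𝒢.Fiber x))
    (f φ : G → ℝ) (γ : G) : ℝ :=
  ∫ γ₁ : 𝒢.Fiber (𝒢.r γ), f (𝒢.mul (𝒢.inv γ₁.1) γ ((𝒢.s_inv _).trans γ₁.2)) * φ γ₁.1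
    ∂(m (𝒢.r γ) : Measure (𝒢.Fiber (𝒢.r γ)))

theorem meanConv_eq (m : (x : X) → FiniteMeasure (𝒢.Fiber x)) (f φ : G → ℝ) {x : X} (γ : G)
    (hγ : 𝒢.r γ = x) : 𝒢.meanConv m f φ γ =
      ∫ γ₁ : 𝒢.Fiber x, f (𝒢.mul (𝒢.inv γ₁.1) γ ((𝒢.s_inv _).trans (γ₁.2.trans hγ.symm))) *
        φ γ₁.1 ∂(m x : Measure (𝒢.Fiber x)) := by
  subst hγ
  rfl

theorem meanConv_mem_ccReal [T2Space G] (hG : IsLocallyCompactSpace G)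
    {m : (x : X) → FiniteMeasure (𝒢.Fiber x)}
    (hm : ∀ f ∈ ccSpan G, Continuous fun x => ∫ γ, f γ.1 ∂(m x : Measure (𝒢.Fiber x)))
    {f φ : G → ℝ} (hf : f ∈ ccReal G) (hφ : φ ∈ ccReal G) : 𝒢.meanConv m f φ ∈ ccReal G := by
  have := hG.locallyCompactSpace
  have hF := 𝒢.inv_mul_mem_ccReal_pullback hf hφ
  rw [mem_ccReal_iff_of_t2]
  refine ⟨continuous_integral_pullback hG
    (fun f hf => continuous_integral_ccReal_of_ccSpan hm hf) 𝒢.continuous_r hF, ?_⟩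
  obtain ⟨K, hK, hK0⟩ := exists_isCompact_of_mem_ccReal hF
  refine HasCompactSupport.intro
    (hK.image (continuous_fst.comp continuous_subtype_val)) fun γ hγ => ?_
  refine integral_eq_zero_of_ae (Eventually.of_forall fun γ₁ => ?_)
  exact hK0 ⟨(γ, γ₁.1), γ₁.2.symm⟩ fun h => hγ ⟨_, h, rfl⟩

theorem IsHaarSystem.integral_inv_mul_fiber (hlam : 𝒢.IsHaarSystem lam) (f : G → ℝ) {x : X}
    (γ₁ : 𝒢.Fiber x) :
    ∫ γ : 𝒢.Fiber x, f (𝒢.mul (𝒢.inv γ₁.1) γ.1 ((𝒢.s_inv _).trans (γ₁.2.trans γ.2.symm)))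
      ∂(lam x) = ∫ γ, f γ.1 ∂(lam (𝒢.s γ₁.1)) := by
  obtain ⟨γ₁, rfl⟩ := γ₁
  exact hlam.integral_inv_mul f γ₁

/-- After Fubini, invariance turns the inner integral into that of `f` against `λ^{s(γ₁)}`, which is
one wherever `φ` is nonzero. -/
theorem IsHaarSystem.integral_meanConv [T2Space G] (hG : IsLocallyCompactSpace G)
    (hlam : 𝒢.IsHaarSystem lam) (m : (x : X) → FiniteMeasure (𝒢.Fiber x)) {f φ : G → ℝ}
    (hf : f ∈ ccReal G) (hφ : φ ∈ ccReal G)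
    (hfφ : ∀ γ, φ γ ≠ 0 → ∫ γ₁, f γ₁.1 ∂(lam (𝒢.s γ)) = 1) (x : X) :
    ∫ γ, 𝒢.meanConv m f φ γ.1 ∂(lam x) = ∫ γ, φ γ.1 ∂(m x : Measure (𝒢.Fiber x)) := by
  have := hlam.isFiniteMeasureOnCompacts
  obtain ⟨h1, h2⟩ := fiber_continuous (𝒢 := 𝒢) hG hφ x
  have h := (isProperKernel_inv_mul hG hf x).integral_integral h1 h2 (m x) (lam x)
  refine (integral_congr_ae (Eventually.of_forall fun γ : 𝒢.Fiber x =>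
    meanConv_eq m f φ γ.1 γ.2)).trans
    (h.trans (integral_congr_ae (Eventually.of_forall fun γ₁ => ?_)))
  beta_reduce
  rw [hlam.integral_inv_mul_fiber f γ₁]
  by_cases h0 : φ γ₁.1 = 0
  · rw [h0, mul_zero]
  · rw [hfφ _ h0, one_mul]

/-- Left translation commutes with convolution by `f` on the right, so it acts only on the mean and
on the cut-off. -/
theorem meanConv_inv_mul (m : (x : X) → FiniteMeasure (𝒢.Fiber x)) (f φ : G → ℝ) (γ₀ : G)
    (γ : 𝒢.Fiber (𝒢.r γ₀)) :
    𝒢.meanConv m f φ (𝒢.mul (𝒢.inv γ₀) γ.1 ((𝒢.s_inv γ₀).trans γ.2.symm)) =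
      ∫ γ₁ : 𝒢.Fiber (𝒢.r γ₀),
        f (𝒢.mul (𝒢.inv γ₁.1) γ.1 ((𝒢.s_inv _).trans (γ₁.2.trans γ.2.symm))) *
          φ (𝒢.mul (𝒢.inv γ₀) γ₁.1 ((𝒢.s_inv γ₀).trans γ₁.2.symm))
        ∂((m (𝒢.s γ₀)).map (𝒢.translate γ₀) : Measure (𝒢.Fiber (𝒢.r γ₀))) := by
  rw [meanConv_eq m f φ _ ((𝒢.r_mul _ _ _).trans (𝒢.r_inv γ₀))]
  symm
  refine ((𝒢.translateHomeomorph γ₀).measurableEmbedding.integral_map _).trans ?_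
  refine integral_congr_ae (Eventually.of_forall fun γ₁ => ?_)
  exact congrArg₂ (fun a b => f a * φ b) (𝒢.inv_mul_mul γ₀ γ₁.1 γ.1 _ _ _ _)
    (𝒢.inv_mul_cancel_left γ₀ γ₁.1 _ _)

theorem HasApproxInvariantMean.hasApproxInvariantDensity [T2Space G]
    (hG : IsLocallyCompactSpace G) [SigmaCompactSpace G] (hlam : 𝒢.IsHaarSystem lam)
    (h : 𝒢.HasApproxInvariantMean) : 𝒢.HasApproxInvariantDensity lam := by
  have := hlam.isFiniteMeasureOnCompacts
  obtain ⟨m, -, hmass, hcont, hL, hK⟩ := h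
  refine hasApproxInvariantDensity_of_forall_isCompact hG fun K hKc L hLc ε hε => ?_
  -- The kernel estimate bounds the defect by less than `2η` from the total variation (the mass of
  -- `b` counts twice) and `η` from each of the two cut-offs.
  obtain ⟨η, hη, hηε⟩ : ∃ η > 0, 4 * η = ε := ⟨ε / 4, by positivity, by ring⟩
  -- The cut-off must capture the mass at both endpoints of every arrow in `K`.
  have hL'c : IsCompact (L ∪ 𝒢.r '' K ∪ 𝒢.s '' K) :=
    (hLc.union (hKc.image 𝒢.continuous_r)).union (hKc.image 𝒢.continuous_s)
  obtain ⟨n, hn1, hn2⟩ := ((Metric.tendstoUniformlyOn_iff.1 (hL _ hL'c) η hη).and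
    (Metric.tendstoUniformlyOn_iff.1 (hK K hKc) η hη)).exists
  obtain ⟨φ, hφ, hφ0, hφ1, hφL⟩ := exists_cutoff_of_mass hG (hcont n) hL'c (c := 1 - η)
    fun x hx => by
      have := (abs_lt.1 ((Real.dist_eq _ _).symm.trans_lt (hn1 x hx))).2
      linarith
  obtain ⟨Q, hQ, hQ0⟩ := exists_isCompact_of_mem_ccReal hφ
  obtain ⟨f, hf, hf0, hf1, hfS⟩ := hlam.exists_normalized hG (hQ.image 𝒢.continuous_s)
  have hfφ : ∀ γ, φ γ ≠ 0 → ∫ γ₁, f γ₁.1 ∂(lam (𝒢.s γ)) = 1 := fun γ hγ =>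
    hfS _ ⟨γ, not_imp_comm.1 (hQ0 γ) hγ, rfl⟩
  have hmass' : ∀ x, (m n x : Measure (𝒢.Fiber x)).real Set.univ ≤ 1 := fun x => hmass n x
  have hφi : ∀ x, Integrable (fun γ : 𝒢.Fiber x => φ γ.1) (m n x : Measure (𝒢.Fiber x)) :=
    fun x => integrable_fiber hG hφ _
  have hdef : ∀ x ∈ L ∪ 𝒢.r '' K ∪ 𝒢.s '' K,
      ∫ γ : 𝒢.Fiber x, (1 - φ γ.1) ∂(m n x : Measure (𝒢.Fiber x)) ≤ η := fun x hx => by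
    rw [integral_sub (integrable_const _) (hφi x), integral_const, smul_eq_mul, mul_one]
    linarith [hφL x hx, hmass' x]
  refine ⟨𝒢.meanConv (m n) f φ, meanConv_mem_ccReal hG (hcont n) hf hφ, fun γ =>
    integral_nonneg fun γ₁ => mul_nonneg (hf0 _) (hφ0 _), fun x => ?_, fun x hx => ?_,
    fun γ₀ hγ₀ => ?_⟩
  · rw [hlam.integral_meanConv hG (m n) hf hφ hfφ]
    obtain ⟨h1, h2⟩ := fiber_continuous (𝒢 := 𝒢) hG hφ x
    exact (integral_le_measureReal_univ h1 h2 (fun γ => hφ1 _) _).trans (hmass' x)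
  · rw [hlam.integral_meanConv hG (m n) hf hφ hfφ]
    linarith [hφL x (Or.inl (Or.inl hx))]
  · have := 𝒢.fiber_t2Space hG (𝒢.r γ₀)
    obtain ⟨a, b, ha, hb, hab, htv⟩ := exists_measure_tvNormSub_eq
      ((m n (𝒢.s γ₀)).map (𝒢.translate γ₀)) (m n (𝒢.r γ₀))
    obtain ⟨h1, h2⟩ := fiber_continuous (𝒢 := 𝒢) hG hφ (𝒢.s γ₀)
    obtain ⟨h3, h4⟩ := fiber_continuous (𝒢 := 𝒢) hG hφ (𝒢.r γ₀)
    have key := (isProperKernel_inv_mul hG hf (𝒢.r γ₀)).integral_abs_sub_le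
      (fun _ _ => hf0 _) (lam := lam (𝒢.r γ₀))
      (fun γ₁ => (hlam.integral_inv_mul_fiber f γ₁).trans_le (hf1 _))
      (h1.comp (𝒢.translateHomeomorph γ₀).symm.continuous)
      (h2.comp_homeomorph (𝒢.translateHomeomorph γ₀).symm) (fun _ => hφ0 _) (fun _ => hφ1 _)
      h3 h4 (fun _ => hφ1 _) hab
    have e1 : ∫ γ₁, (1 - ((fun γ : 𝒢.Fiber (𝒢.s γ₀) => φ γ.1) ∘
        (𝒢.translateHomeomorph γ₀).symm) γ₁)
          ∂((m n (𝒢.s γ₀)).map (𝒢.translate γ₀) : Measure (𝒢.Fiber (𝒢.r γ₀))) ≤ η := by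
      refine le_trans (le_of_eq ?_) (hdef _ (Or.inr ⟨γ₀, hγ₀, rfl⟩))
      refine ((𝒢.translateHomeomorph γ₀).measurableEmbedding.integral_map _).trans ?_
      refine integral_congr_ae (Eventually.of_forall fun γ₁ => ?_)
      simp
    have e2 := hdef _ (Or.inl (Or.inr ⟨γ₀, hγ₀, rfl⟩))
    have e3 : a.real Set.univ + b.real Set.univ < η := by
      rw [← htv]
      have := hn2 γ₀ hγ₀
      rwa [dist_comm, dist_zero_right, Real.norm_of_nonneg (tvNormSub_nonneg _ _)] at this
    have e4 : 0 ≤ a.real Set.univ := measureReal_nonneg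
    have e5 : 𝒢.translationDefect lam (𝒢.meanConv (m n) f φ) γ₀ ≤ _ :=
      le_trans (le_of_eq (integral_congr_ae (Eventually.of_forall fun γ =>
        congrArg₂ (fun s t : ℝ => |s - t|) (meanConv_inv_mul (m n) f φ γ₀ γ)
          (meanConv_eq (m n) f φ γ.1 γ.2)))) key
    linarith

/-- Extension off a fibre is an argument about functions, so each mean on `G(t)` is first turned
into a density; the densities are glued and the result is read as a mean again. -/
theorem hasApproxInvariantMean_of_bundleFiber [T2Space G] [T2Space T] [LocallyCompactSpace T]
    (hG : IsLocallyCompactSpace G) [SigmaCompactSpace G] (hlam : 𝒢.IsHaarSystem lam) {p : X → T}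
    (hp : 𝒢.IsGroupoidBundle p) (h : ∀ t, (𝒢.bundleFiber hp t).HasApproxInvariantMean) :
    𝒢.HasApproxInvariantMean := by
  refine (hasApproxInvariantDensity_of_bundleFiber hG hlam hp fun t => ?_).hasApproxInvariantMean
    hG hlam
  have hAc : IsClosed (p ⁻¹' {t}) := isClosed_singleton.preimage hp.continuous
  have hj := 𝒢.isClosedEmbedding_redArrows hAc
  have : SigmaCompactSpace (𝒢.RedArrows (p ⁻¹' {t})) := hj.sigmaCompactSpace
  exact (h t).hasApproxInvariantDensity (hG.of_isClosedEmbedding hj)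
    (hlam.reduction hG (hp.preimage_invariant t) hAc)

end TopGroupoid

theorem mainTheorem3 {G X T : Type*} [TopologicalSpace G] [TopologicalSpace X]
    [TopologicalSpace T] [LocallyCompactSpace T] [T2Space T]
    (𝒢 : TopGroupoid G X) (hG : IsLocallyCompactSpace G) [SigmaCompactSpace G]
    (lam : (x : X) → MeasureTheory.Measure (𝒢.Fiber x)) (hlam : 𝒢.IsHaarSystem lam)
    (p : X → T) (hp : 𝒢.IsGroupoidBundle p) :
    (𝒢.HasApproxInvariantDensity lam ↔
      ∀ t : T, (𝒢.bundleFiber hp t).HasApproxInvariantDensity (𝒢.bundleFiberSystem lam hp t)) ∧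
    (𝒢.HasApproxInvariantMean → ∀ t : T, (𝒢.bundleFiber hp t).HasApproxInvariantMean) ∧
    (T2Space G →
      (∀ t : T, (𝒢.bundleFiber hp t).HasApproxInvariantMean) → 𝒢.HasApproxInvariantMean) := by
  refine ⟨TopGroupoid.hasApproxInvariantDensity_iff_bundleFiber hG hlam hp, fun h t => ?_,
    fun _ h => TopGroupoid.hasApproxInvariantMean_of_bundleFiber hG hlam hp h⟩
  exact h.reduction hG (hp.preimage_invariant t) (isClosed_singleton.preimage hp.continuous)
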